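/- **Setting.** Let $\mathcal X\subseteq\mathbb R^p$ be convex and let $f:\operatorname{int}\mathcal X\to\mathbb R$ (extended by $+\infty$) be a $\nu_f$-self-concordant barrier of $\mathcal X$, $\nu_f\ge 1$: $f$ is convex and $C^3$ on $\operatorname{dom} f=\operatorname{int}\mathcal X$, $|\langle\nabla^3f(x)[u]u,u\rangle|\le 2\langle\nabla^2f(x)u,u\rangle^{3/2}$, $f(x)\to+\infty$ as $x$ approaches $\partial\mathcal X$, and $\sup_u\{2\langle\nabla f(x),u\rangle-\langle\nabla^2 f(x)u,u\rangle\}\le\nu_f$ for all $x\in\operatorname{dom} f$. Assume $\nabla^2f(x)\succ0$ on $\operatorname{dom} f$ and write $\|u\|_x=\langle\nabla^2f(x)u,u\rangle^{1/2}$, $\|v\|_x^*=\langle\nabla^2f(x)^{-1}v,v\rangle^{1/2}$. Let $g:\mathbb R^p\to\mathbb R\cup\{+\infty\}$ be proper, closed and convex, and let $x^\star$ be a minimizer of $F=f+g$ (assumed to exist). Let $x^0\in\operatorname{dom} f\cap\operatorname{dom} g$ and $\xi^0\in\partial g(x^0)$, and assume that either the analytic center $x_f^\star=\arg\min_{\operatorname{int}\mathcal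 X}f$ exists or $\xi^0=0$. Put $\bar c_0=\theta_f\|\xi^0\|^*_{x_f^\star}$ if $x_f^\star$ exists and $\bar c_0=0$ otherwise, where $\theta_f=1$ if $f$ is logarithmically homogeneous ($f(tx)=f(x)-\nu_f\log t$ for all $x\in\operatorname{int}\mathcal X$, $t>0$) and $\theta_f=\nu_f+2\sqrt{\nu_f}$ otherwise. For $\tau\in(0,1]$ let $$x^*_\tau=\arg\min_x\{\tau f(x)-(1-\tau)\langle\xi^0,x\rangle+g(x)\}.$$ **Parameters.** Let $\tau_0\in(0,1)$ and $\sigma\in(0.318642,1]$ satisfy $$C_0:=\frac{\sqrt{\sigma-0.01}}{10}-\frac1{18}>0,\qquad \sigma\ge\Big(1-\frac{\tau_0C_0}{(1-\tau_0)(1+C_0)(\sqrt{\nu_f}+\bar c_0)}\Big)^2,$$ let $\beta=0.05$, and suppose $\|x^0-x^*_{\tau_0}\|_{x^*_{\tau_0}}\le\beta$. **Scheme.** For $k\ge0$ let $$\tau_{k+1}=\min\Big\{1,\Big(1+\frac{\Delta_k}{(1+\Delta_k)(\sqrt{\nu_f}+\bar c_0)}\Big)\tau_k\Big\},\qquad \Delta_k=\Big(\frac{\sqrt{\sigma-0.01}}{10}-\frac{\sqrt\sigma^{\,k}}{18}\Big)\sqrt\sigma^{\,k},$$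 and let $x^{k+1}$ be a $\delta_k$-approximate proximal-Newton step, i.e. $\mathcal P_k(x^{k+1})-\min\mathcal P_k\le\delta_k^2/2$, where $$\mathcal P_k(x)=\big\langle\nabla f(x^k)-(\tfrac1{\tau_{k+1}}-1)\xi^0,x-x^k\big\rangle+\tfrac12\langle\nabla^2f(x^k)(x-x^k),x-x^k\rangle+\tfrac1{\tau_{k+1}}g(x)$$ and $0\le\delta_k\le\frac1{113}\|x^k-x^*_{\tau_k}\|_{x^*_{\tau_k}}$. **Theorem.** The minimizer $x^*_\tau$ exists and is unique for every $\tau\in(0,1]$, and for all $k\ge0$: 1. $\|x^k-x^*_{\tau_k}\|_{x^*_{\tau_k}}\le\beta\sigma^k$ and $0\le 1-\tau_k$. 2. If $\sigma<1$, then $1-\tau_k\le\dfrac{C_0\sqrt\sigma^{\,k}}{(1+C_0)(\sqrt{\nu_f}+\bar c_0)(1-\sqrt\sigma)}$; hence $\|x^k-x^*_{\tau_k}\|_{x^*_{\tau_k}}$ and $1-\tau_k$ both converge to $0$ at a linear rate. 3. If $\widetilde C_1:=\dfrac{C_0}{\tau_0(1+C_0)(1-\sqrt\sigma)-C_0}>0$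 (which forces $\sigma<1$), then for every $k$ with $\widetilde C_1\sqrt\sigma^{\,k}<1$ $$\|x^k-x^\star\|_{x^\star}\le\frac{\beta\sigma^k}{1-\widetilde C_1\sqrt\sigma^{\,k}}+\widetilde C_1\sqrt\sigma^{\,k}.$$ Hence there is a constant $C$ with $\|x^k-x^\star\|_{x^\star}\le C\sqrt\sigma^{\,k}$ for all $k$, and $x^k\to x^\star$ at a linear rate. Moreover, for the given value of $\sqrt{\nu_f}+\bar c_0$ there always exist $\tau_0\in(0,1)$ and $\sigma\in(0.318642,1)$ satisfying the two conditions on the parameters together with $\widetilde C_1>0$. -/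

import Mathlib

open Set Filter Topology

noncomputable section

namespace HomotopyPN

/-- `ℝᵖ` with its Euclidean structure. -/
abbrev Vec (p : ℕ) := EuclideanSpace ℝ (Fin p)

variable {p : ℕ}

/-! ### Local norms -/

/-- The Hessian `∇²f(x)` as a linear operator. -/
def hess (f : Vec p → ℝ) (x : Vec p) : Vec p →L[ℝ] Vec p := fderiv ℝ (gradient f) x

/-- `‖u‖ₓ = ⟨∇²f(x)u, u⟩^{1/2}`. -/
def localNorm (f : Vec p → ℝ) (x u : Vec p) : ℝ := √(inner ℝ (hess f x u) u)

/-- `‖v‖ₓ* = ⟨∇²f(x)⁻¹v, v⟩^{1/2}`. -/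
def dualLocalNorm (f : Vec p → ℝ) (x v : Vec p) : ℝ :=
  √(inner ℝ ((hess f x).inverse v) v)

/-! ### Self-concordant barriers -/

/-- `f` (with `dom f = int X`) is three times continuously differentiable, convex, and
`|⟨∇³f(x)[u]u, u⟩| ≤ 2 ⟨∇²f(x)u, u⟩^{3/2}` on its domain. -/
structure IsStdSelfConcordant (X : Set (Vec p)) (f : Vec p → ℝ) : Prop where
  contDiffOn : ContDiffOn ℝ 3 f (interior X)
  convexOn : ConvexOn ℝ (interior X) f
  third_le : ∀ x ∈ interior X, ∀ u : Vec p,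
    |inner ℝ (fderiv ℝ (hess f) x u u) u| ≤ 2 * (inner ℝ (hess f x u) u) ^ (3 / 2 : ℝ)

/-- `f` is a `ν`-self-concordant barrier of the convex set `X`. -/
structure IsSelfConcordantBarrier (X : Set (Vec p)) (f : Vec p → ℝ) (ν : ℝ) : Prop where
  one_le : 1 ≤ ν
  convex : Convex ℝ X
  selfConcordant : IsStdSelfConcordant X f
  tendsto_boundary : ∀ y ∈ frontier X, Tendsto f (𝓝[interior X] y) atTop
  sup_le : ∀ x ∈ interior X, ∀ u : Vec p,
    2 * inner ℝ (gradient f x) u - localNorm f x u ^ 2 ≤ ν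

/-- Logarithmic homogeneity: `f(t x) = f(x) - ν log t` on `int X` for `t > 0`. -/
def IsLogHomogeneous (X : Set (Vec p)) (f : Vec p → ℝ) (ν : ℝ) : Prop :=
  ∀ x ∈ interior X, ∀ t : ℝ, 0 < t →
    t • x ∈ interior X ∧ f (t • x) = f x - ν * Real.log t

open Classical in
/-- `θ_f`: equal to `1` for logarithmically homogeneous barriers, `ν + 2√ν` otherwise. -/
def theta (X : Set (Vec p)) (f : Vec p → ℝ) (ν : ℝ) : ℝ :=
  if IsLogHomogeneous X f ν then 1 else ν + 2 * √ν

/-! ### Extended-valued convex functions -/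

/-- Proper, closed and convex, for `g : ℝᵖ → ℝ ∪ {+∞}`. -/
structure IsProperClosedConvex (g : Vec p → EReal) : Prop where
  ne_bot : ∀ x, g x ≠ ⊥
  exists_ne_top : ∃ x, g x ≠ ⊤
  closed : LowerSemicontinuous g
  convex_epigraph : Convex ℝ {q : Vec p × ℝ | g q.1 ≤ (q.2 : EReal)}

/-- `ξ ∈ ∂g(x)`. -/
def IsSubgradient (g : Vec p → EReal) (x ξ : Vec p) : Prop :=
  g x ≠ ⊤ ∧ ∀ y, g x + ((inner ℝ ξ (y - x) : ℝ) : EReal) ≤ g y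

open Classical in
/-- The function equal to `h` on `int X` and to `+∞` elsewhere. -/
def extendTop (X : Set (Vec p)) (h : Vec p → ℝ) (x : Vec p) : EReal :=
  if x ∈ interior X then (h x : EReal) else ⊤

/-- `x` is a minimizer, with finite value, of `Φ` over `ℝᵖ`. -/
def IsArgmin (Φ : Vec p → EReal) (x : Vec p) : Prop :=
  Φ x ≠ ⊤ ∧ ∀ y, Φ x ≤ Φ y

open Classical in
/-- A minimizer of `Φ` (the default `0` if there is none). -/
def argmin (Φ : Vec p → EReal) : Vec p :=
  if h : ∃ x, IsArgmin Φ x then h.choose else 0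

/-! ### The composite problem, its parametrization and the scheme -/

/-- `F = f + g`, with `dom f = int X`. -/
def objective (X : Set (Vec p)) (f : Vec p → ℝ) (g : Vec p → EReal) (x : Vec p) : EReal :=
  extendTop X f x + g x

/-- `F_τ = f_τ + g` with `f_τ(x) = τ f(x) - (1 - τ)⟨ξ, x⟩`. -/
def paramObjective (X : Set (Vec p)) (f : Vec p → ℝ) (g : Vec p → EReal) (ξ : Vec p) (τ : ℝ)
    (x : Vec p) : EReal :=
  extendTop X (fun z => τ * f z - (1 - τ) * inner ℝ ξ z) x + g x

/-- `x*_τ`, the minimizer of `F_τ`. -/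
def paramSol (X : Set (Vec p)) (f : Vec p → ℝ) (g : Vec p → EReal) (ξ : Vec p) (τ : ℝ) : Vec p :=
  argmin (paramObjective X f g ξ τ)

/-- `‖x - x*_τ‖` in the local norm at `x*_τ`. -/
def localDist (X : Set (Vec p)) (f : Vec p → ℝ) (g : Vec p → EReal) (ξ : Vec p) (τ : ℝ)
    (x : Vec p) : ℝ :=
  localNorm f (paramSol X f g ξ τ) (x - paramSol X f g ξ τ)

/-- `x` is an analytic center: a minimizer of `f` over `int X`. -/
def IsAnalyticCenter (X : Set (Vec p)) (f : Vec p → ℝ) (x : Vec p) : Prop :=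
  IsArgmin (extendTop X f) x

open Classical in
/-- `c̄₀ = θ_f ‖ξ‖*` in the dual local norm at the analytic center if the latter exists, and `0`
otherwise. -/
def cbar (X : Set (Vec p)) (f : Vec p → ℝ) (ν : ℝ) (ξ : Vec p) : ℝ :=
  if ∃ z, IsAnalyticCenter X f z then
    theta X f ν * dualLocalNorm f (argmin (extendTop X f)) ξ
  else 0

/-- The model at the current iterate `x` for the parameter value `τ`:
`P(z) = ⟨∇f(x) - (1/τ - 1)ξ, z - x⟩ + ½⟨∇²f(x)(z - x), z - x⟩ + (1/τ) g(z)`. -/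
def subproblem (f : Vec p → ℝ) (g : Vec p → EReal) (ξ : Vec p) (τ : ℝ) (x z : Vec p) : EReal :=
  ((inner ℝ (gradient f x - (1 / τ - 1) • ξ) (z - x)
      + 1 / 2 * inner ℝ (hess f x (z - x)) (z - x) : ℝ) : EReal)
    + ((1 / τ : ℝ) : EReal) * g z

/-- `x'` is a `δ`-approximate solution of the proximal-Newton subproblem at `x`: its value
exceeds that of the exact solution by at most `δ²/2`. -/
def IsInexactStep (f : Vec p → ℝ) (g : Vec p → EReal) (ξ : Vec p) (τ δ : ℝ) (x x' : Vec p) :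
    Prop :=
  ∃ xbar, IsArgmin (subproblem f g ξ τ x) xbar ∧
    subproblem f g ξ τ x x' ≤ subproblem f g ξ τ x xbar + ((δ ^ 2 / 2 : ℝ) : EReal)

/-! ### Constants -/

/-- `C₀ = √(σ - 0.01)/10 - 1/18`. -/
def C₀ (σ : ℝ) : ℝ := √(σ - 0.01) / 10 - 1 / 18

/-- `Δ_k = (√(σ - 0.01)/10 - (√σ)^k/18) (√σ)^k`. -/
def Δ (σ : ℝ) (k : ℕ) : ℝ := (√(σ - 0.01) / 10 - √σ ^ k / 18) * √σ ^ k

/-- The condition on `σ`, for given `τ₀` and `s = √ν_f + c̄₀`. -/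
def SigmaCondition (s τ₀ σ : ℝ) : Prop :=
  0 < C₀ σ ∧ (1 - τ₀ * C₀ σ / ((1 - τ₀) * (1 + C₀ σ) * s)) ^ 2 ≤ σ

/-- `C̃₁ = C₀ / (τ₀ (1 + C₀)(1 - √σ) - C₀)`. -/
def Ctilde (τ₀ σ : ℝ) : ℝ := C₀ σ / (τ₀ * (1 + C₀ σ) * (1 - √σ) - C₀ σ)

end HomotopyPN

end

/-!
The Hessian of a self-concordant function varies in a controlled way: local norms at points of local
distance `r < 1` are equivalent up to the factor `1 - r`. For a barrier, `ξ⁰ + ∇f` is bounded by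
`s = √ν_f + c̄₀` in the dual local norms. Monotonicity of `∂g` turns this bound into
`τ' r ≤ |τ' - τ| s (1 + r)` for the local distance `r` of `x*_τ` and `x*_{τ'}`; the update of `τ_k`
is small enough for this to give `r ≤ Δ_k`. Hence `x^k`, which is within `β σ^k` of the old point of
the path, is within about `β σ^k + Δ_k` of the new one, and the proximal-Newton step contracts this
distance quadratically, up to the error `δ_k`, to at most `β σ^(k+1)`. As `Δ_k ≥ C₀ √σ^k`, the
parameters `τ_k` approach `1` geometrically, and the same estimate along the path transfers the rate
to `x* = x*_1`.
-/

noncomputable section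

namespace HomotopyPN

variable {p : ℕ}

/-! ### Polarization of bilinear and trilinear forms -/

section Polarization

variable {V : Type*} [AddCommGroup V] [Module ℝ V] {B : LinearMap.BilinForm ℝ V}

theorem sq_apply_le_of_abs_apply_self_le {A : LinearMap.BilinForm ℝ V} {c : ℝ} (hA : A.IsSymm)
    (hB : B.IsSymm) (hAB : ∀ u, |A u u| ≤ c * B u u) (u v : V) :
    A u v ^ 2 ≤ c ^ 2 * (B u u * B v v) := by
  -- Cauchy–Schwarz for the two positive semidefinite forms `P = c B + A` and `N = c B - A`
  obtain ⟨P, hP⟩ : ∃ P, P = c • B + A := ⟨_, rfl⟩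
  obtain ⟨N, hN⟩ : ∃ N, N = c • B - A := ⟨_, rfl⟩
  have hP₀ (w : V) : 0 ≤ P w w := by
    simpa [hP] using neg_le_iff_add_nonneg'.1 (abs_le.1 (hAB w)).1
  have hN₀ (w : V) : 0 ≤ N w w := by simpa [hN] using (abs_le.1 (hAB w)).2
  have hPuv : P u v ^ 2 ≤ P u u * P v v := LinearMap.BilinForm.apply_sq_le_of_symm P hP₀
    (LinearMap.BilinForm.isSymm_iff.1 (hP ▸ (hB.smul c).add hA)) u v
  have hNuv : N u v ^ 2 ≤ N u u * N v v := LinearMap.BilinForm.apply_sq_le_of_symm N hN₀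
    (LinearMap.BilinForm.isSymm_iff.1 (hN ▸ (hB.smul c).sub hA)) u v
  have hcross : |2 * (P u v * N u v)| ≤ P u u * N v v + P v v * N u u := by
    refine abs_le_of_sq_le_sq ?_ (add_nonneg (mul_nonneg (hP₀ u) (hN₀ v))
      (mul_nonneg (hP₀ v) (hN₀ u)))
    nlinarith [mul_le_mul hPuv hNuv (sq_nonneg _) (mul_nonneg (hP₀ u) (hP₀ v)),
      sq_nonneg (P u u * N v v - P v v * N u u)]
  have hA₂ : 2 * A u v = P u v - N u v := by
    simp only [hP, hN, LinearMap.add_apply, LinearMap.sub_apply]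
    ring
  have hB₂ (w : V) : 2 * (c * B w w) = P w w + N w w := by
    simp only [hP, hN, LinearMap.add_apply, LinearMap.sub_apply, LinearMap.smul_apply, smul_eq_mul]
    ring
  calc A u v ^ 2 = (2 * A u v) ^ 2 / 4 := by ring
    _ ≤ (P u u + N u u) * (P v v + N v v) / 4 := by
      rw [hA₂]
      linarith [(abs_le.1 hcross).1]
    _ = c ^ 2 * (B u u * B v v) := by rw [← hB₂, ← hB₂]; ring

/-- A cubic form sampled at angle `θ`, with the Fejér weight `(sin 3θ / (3 sin θ)) ^ 2`. -/
theorem fejer_weight_mul_cubic_le {a b d e M : ℝ}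
    (h : ∀ θ : ℝ, a * Real.cos θ ^ 3 + 3 * b * Real.cos θ ^ 2 * Real.sin θ
      + 3 * d * Real.cos θ * Real.sin θ ^ 2 + e * Real.sin θ ^ 3 ≤ M)
    {θ K L : ℝ} (hK : Real.cos (3 * θ) = K) (hL : Real.sin (3 * θ) = L) :
    a * (K ^ 2 * Real.cos θ + 4 * K * Real.cos θ ^ 2 + K + 3 * Real.cos θ)
      + 3 * b * L * (K * Real.cos θ + 2 * Real.cos θ ^ 2)
      + 3 * d * L ^ 2 * Real.cos θ + e * L ^ 2 * Real.sin θ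
      ≤ M * (4 * K * Real.cos θ + 4 * Real.cos θ ^ 2 + 1) := by
  rw [Real.cos_three_mul] at hK
  rw [Real.sin_three_mul] at hL
  have hθ := Real.cos_sq_add_sin_sq θ
  have hM := mul_le_mul_of_nonneg_left (h θ) (sq_nonneg (4 * Real.cos θ ^ 2 - 1))
  generalize Real.cos θ = c at *
  generalize Real.sin θ = s at *
  have hc : (4 * c ^ 2 - 1) * c = K + 2 * c := by linear_combination hK
  have hs : (4 * c ^ 2 - 1) * s = L := by linear_combination hL + 4 * s * hθ
  calc _ = a * c * (K + 2 * c) ^ 2 + 3 * b * c * (K + 2 * c) * L + 3 * d * c * L ^ 2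
        + e * s * L ^ 2 := by linear_combination -a * hK
    _ = (4 * c ^ 2 - 1) ^ 2 *
        (a * c ^ 3 + 3 * b * c ^ 2 * s + 3 * d * c * s ^ 2 + e * s ^ 3) := by
      rw [← hc, ← hs]; ring
    _ ≤ (4 * c ^ 2 - 1) ^ 2 * M := hM
    _ = _ := by linear_combination 4 * M * c * hK

/-- The left-hand side is the weighted mean of the values of the cubic form at the three angles
`(α + 2πj) / 3`, with Fejér weights. -/
theorem cubic_leading_le {a b d e M : ℝ}
    (h : ∀ θ : ℝ, a * Real.cos θ ^ 3 + 3 * b * Real.cos θ ^ 2 * Real.sin θ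
      + 3 * d * Real.cos θ * Real.sin θ ^ 2 + e * Real.sin θ ^ 3 ≤ M) (α : ℝ) :
    a * Real.cos α + b * Real.sin α ≤ M := by
  have h₀ := fejer_weight_mul_cubic_le h (θ := α / 3) (K := Real.cos α) (L := Real.sin α)
    (by ring_nf) (by ring_nf)
  have h₁ := fejer_weight_mul_cubic_le h (θ := α / 3 + 2 * (Real.pi / 3)) (K := Real.cos α)
    (L := Real.sin α) (by rw [← Real.cos_add_two_pi α]; ring_nf)
    (by rw [← Real.sin_add_two_pi α]; ring_nf)
  have h₂ := fejer_weight_mul_cubic_le h (θ := α / 3 - 2 * (Real.pi / 3)) (K := Real.cos α)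
    (L := Real.sin α) (by rw [← Real.cos_sub_two_pi α]; ring_nf)
    (by rw [← Real.sin_sub_two_pi α]; ring_nf)
  have hcos : Real.cos (2 * (Real.pi / 3)) = -(1 / 2) := by
    rw [Real.cos_two_mul, Real.cos_pi_div_three]
    norm_num
  have hsin : Real.sin (2 * (Real.pi / 3)) ^ 2 = 3 / 4 := by
    rw [Real.sin_sq, hcos]
    norm_num
  have hcs := Real.cos_sq_add_sin_sq (α / 3)
  simp only [Real.cos_add, Real.sin_add, Real.cos_sub, Real.sin_sub, hcos] at h₁ h₂
  generalize Real.cos (α / 3) = c at *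
  generalize Real.sin (α / 3) = s at *
  generalize Real.cos α = K at *
  generalize Real.sin α = L at *
  generalize Real.sin (2 * (Real.pi / 3)) = S at *
  have hsum : c ^ 2 + (c * -(1 / 2) - s * S) ^ 2 + (c * -(1 / 2) + s * S) ^ 2 = 3 / 2 := by
    linear_combination 3 / 2 * hcs + 2 * s ^ 2 * hsin
  linear_combination (h₀ + h₁ + h₂) / 9 - (4 * a * K / 9 + 6 * b * L / 9 - 4 * M / 9) * hsum

theorem exists_orthogonal_decomposition (hB : B.IsSymm) (hpos : ∀ u, u ≠ 0 → 0 < B u u) {v : V}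
    (hv : B v v = 1) (u : V) :
    ∃ (k m : ℝ) (e : V), u = k • v + m • e ∧ B v e = 0 ∧ B e e ≤ 1 ∧ k ^ 2 + m ^ 2 = B u u := by
  obtain ⟨k, w, huw, hvw⟩ : ∃ (k : ℝ) (w : V), u = k • v + w ∧ B v w = 0 :=
    ⟨B v u, u - B v u • v, by abel, by simp [hv]⟩
  have huu : B u u = k ^ 2 + B w w := by
    simp only [huw, map_add, map_smul, LinearMap.add_apply, LinearMap.smul_apply, smul_eq_mul,
      hv, hvw, hB.eq w v]
    ring
  rcases eq_or_ne w 0 with rfl | hw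
  · exact ⟨k, 0, 0, by simpa using huw, by simp, by simp, by simpa using huu.symm⟩
  have hww := hpos w hw
  refine ⟨k, √(B w w), (√(B w w))⁻¹ • w, ?_, by simp [hvw], ?_, ?_⟩
  · rw [smul_inv_smul₀ (Real.sqrt_pos.2 hww).ne', huw]
  · simp only [map_smul, LinearMap.smul_apply, smul_eq_mul]
    rw [← mul_assoc, ← mul_inv, Real.mul_self_sqrt hww.le, inv_mul_cancel₀ hww.ne']
  · rw [Real.sq_sqrt hww.le, huu]

variable {T : V →ₗ[ℝ] V →ₗ[ℝ] V →ₗ[ℝ] ℝ} {c : ℝ}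

theorem trilinear_apply_le_of_apply_self_le_of_eq_one (hB : B.IsSymm)
    (hpos : ∀ u, u ≠ 0 → 0 < B u u) (hl : ∀ u v w, T u v w = T v u w)
    (hr : ∀ u v w, T u v w = T u w v) (hc : 0 ≤ c) (hT : ∀ u, T u u u ≤ c * √(B u u) ^ 3)
    {v : V} (hv : B v v = 1) (u : V) : T u v v ≤ c * √(B u u) := by
  obtain ⟨k, m, e, rfl, hve, hee, hkm⟩ := exists_orthogonal_decomposition hB hpos hv u
  have hcircle (θ : ℝ) : T v v v * Real.cos θ ^ 3 + 3 * T e v v * Real.cos θ ^ 2 * Real.sin θ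
      + 3 * T v e e * Real.cos θ * Real.sin θ ^ 2 + T e e e * Real.sin θ ^ 3 ≤ c := by
    set w := Real.cos θ • v + Real.sin θ • e
    have hw : T w w w = T v v v * Real.cos θ ^ 3 + 3 * T e v v * Real.cos θ ^ 2 * Real.sin θ
        + 3 * T v e e * Real.cos θ * Real.sin θ ^ 2 + T e e e * Real.sin θ ^ 3 := by
      simp only [w, map_add, map_smul, LinearMap.add_apply, LinearMap.smul_apply, smul_eq_mul,
        hr v v e, hl v e v, hl e v e, hr e e v]
      ring
    have hBw : B w w ≤ 1 := by
      simp only [w, map_add, map_smul, LinearMap.add_apply, LinearMap.smul_apply, smul_eq_mul,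
        hv, hve, hB.eq e v]
      nlinarith [Real.cos_sq_add_sin_sq θ, sq_nonneg (Real.sin θ)]
    rw [← hw]
    exact (hT w).trans <|
      mul_le_of_le_one_right hc (pow_le_one₀ (Real.sqrt_nonneg _) (Real.sqrt_le_one.2 hBw))
  set z : ℂ := ⟨k, m⟩
  have hz : ‖z‖ = √(B (k • v + m • e) (k • v + m • e)) := by
    rw [← hkm, Complex.norm_def, Complex.normSq_mk]
    ring_nf
  calc T (k • v + m • e) v v
      = T v v v * (‖z‖ * Real.cos z.arg) + T e v v * (‖z‖ * Real.sin z.arg) := by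
        rw [Complex.norm_mul_cos_arg, Complex.norm_mul_sin_arg]
        simp only [z, map_add, map_smul, LinearMap.add_apply, LinearMap.smul_apply, smul_eq_mul]
        ring
    _ = (T v v v * Real.cos z.arg + T e v v * Real.sin z.arg) * ‖z‖ := by ring
    _ ≤ c * ‖z‖ := by gcongr; exact cubic_leading_le hcircle z.arg
    _ = _ := by rw [hz]

theorem abs_trilinear_apply_le_of_abs_apply_self_le (hB : B.IsSymm)
    (hpos : ∀ u, u ≠ 0 → 0 < B u u) (hl : ∀ u v w, T u v w = T v u w)
    (hr : ∀ u v w, T u v w = T u w v) (hc : 0 ≤ c) (hT : ∀ u, |T u u u| ≤ c * √(B u u) ^ 3)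
    (u v : V) : |T u v v| ≤ c * √(B u u) * B v v := by
  rcases eq_or_ne v 0 with rfl | hv
  · simp
  have hvv := hpos v hv
  have hunit : B ((√(B v v))⁻¹ • v) ((√(B v v))⁻¹ • v) = 1 := by
    simp only [map_smul, LinearMap.smul_apply, smul_eq_mul]
    rw [← mul_assoc, ← mul_inv, Real.mul_self_sqrt hvv.le, inv_mul_cancel₀ hvv.ne']
  have hle (w : V) : T w v v ≤ c * √(B w w) * B v v := by
    have h := trilinear_apply_le_of_apply_self_le_of_eq_one hB hpos hl hr hc
      (fun u => (le_abs_self _).trans (hT u)) hunit w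
    simp only [map_smul, LinearMap.smul_apply, smul_eq_mul] at h
    rwa [← mul_assoc, ← mul_inv, Real.mul_self_sqrt hvv.le, inv_mul_le_iff₀ hvv,
      mul_comm (B v v)] at h
  exact abs_le'.2 ⟨hle u, by simpa using hle (-u)⟩

end Polarization

/-! ### Calculus along lines -/

theorem hasDerivAt_line {E : Type*} [NormedAddCommGroup E] [NormedSpace ℝ E]
    (x u : E) (t : ℝ) : HasDerivAt (fun s : ℝ => x + s • u) u t := by
  simpa using ((hasDerivAt_id t).smul_const u).const_add x

theorem hasDerivAt_inv_one_sub (r : ℝ) {t : ℝ} (ht : 1 - t * r ≠ 0) :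
    HasDerivAt (fun s : ℝ => (1 - s * r)⁻¹) (r / (1 - t * r) ^ 2) t := by
  simpa using! (((hasDerivAt_id t).mul_const r).const_sub 1).inv ht

section Comparison

variable {φ ψ φ' ψ' : ℝ → ℝ} {T : ℝ}

theorem sub_le_sub_of_hasDerivAt_le (hT : 0 ≤ T) (hφ : ∀ t ∈ Icc 0 T, HasDerivAt φ (φ' t) t)
    (hψ : ∀ t ∈ Icc 0 T, HasDerivAt ψ (ψ' t) t) (hle : ∀ t ∈ Icc 0 T, φ' t ≤ ψ' t) :
    φ T - φ 0 ≤ ψ T - ψ 0 := by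
  have hd (t : ℝ) (ht : t ∈ Icc 0 T) : HasDerivAt (ψ - φ) (ψ' t - φ' t) t :=
    (hψ t ht).sub (hφ t ht)
  have hmono : MonotoneOn (ψ - φ) (Icc 0 T) := by
    refine monotoneOn_of_hasDerivWithinAt_nonneg (convex_Icc 0 T)
      (fun t ht => (hd t ht).continuousAt.continuousWithinAt)
      (fun t ht => (hd t (interior_subset ht)).hasDerivWithinAt)
      (fun t ht => sub_nonneg.2 (hle t (interior_subset ht)))
  have h := hmono (left_mem_Icc.2 hT) (right_mem_Icc.2 hT) hT
  simp only [Pi.sub_apply] at h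
  linarith

theorem abs_sub_le_sub_of_abs_hasDerivAt_le (hT : 0 ≤ T)
    (hφ : ∀ t ∈ Icc 0 T, HasDerivAt φ (φ' t) t) (hψ : ∀ t ∈ Icc 0 T, HasDerivAt ψ (ψ' t) t)
    (hle : ∀ t ∈ Icc 0 T, |φ' t| ≤ ψ' t) : |φ T - φ 0| ≤ ψ T - ψ 0 := by
  refine abs_le'.2 ⟨sub_le_sub_of_hasDerivAt_le hT hφ hψ fun t ht => (abs_le'.1 (hle t ht)).1, ?_⟩
  have h := sub_le_sub_of_hasDerivAt_le hT (fun t ht => (hφ t ht).neg) hψ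
    fun t ht => (abs_le'.1 (hle t ht)).2
  simp only [Pi.neg_apply] at h
  linarith

end Comparison

/-! ### Derivatives of a `C³` function and their symmetries -/

section Derivatives

variable {f : Vec p → ℝ} {x : Vec p}

/-- The third derivative `∇³f(x)` as a trilinear form, `third f x u v w = ⟨∇³f(x)[u]v, w⟩`. -/
def third (f : Vec p → ℝ) (x : Vec p) : Vec p →ₗ[ℝ] Vec p →ₗ[ℝ] Vec p →ₗ[ℝ] ℝ :=
  (fderiv ℝ (hess f) x).toLinearMap₁₂.compr₂ (innerₗ (Vec p))

/-- The quadratic form of the Hessian, in its bilinear version: `hessForm f x u v = ⟨∇²f(x)u, v⟩`,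
so that `localNorm f x u = √(hessForm f x u u)`. -/
def hessForm (f : Vec p → ℝ) (x : Vec p) : LinearMap.BilinForm ℝ (Vec p) :=
  (innerₗ (Vec p)).comp (hess f x).toLinearMap

theorem contDiffAt_gradient (hf : ContDiffAt ℝ 3 f x) : ContDiffAt ℝ 2 (gradient f) x :=
  (InnerProductSpace.toDual ℝ (Vec p)).symm.contDiff.contDiffAt.comp x
    (hf.fderiv_right (by norm_num))

theorem hasFDerivAt_gradient (hf : ContDiffAt ℝ 3 f x) : HasFDerivAt (gradient f) (hess f x) x :=
  ((contDiffAt_gradient hf).differentiableAt (by norm_num)).hasFDerivAt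

theorem hasFDerivAt_hess (hf : ContDiffAt ℝ 3 f x) :
    HasFDerivAt (hess f) (fderiv ℝ (hess f) x) x :=
  (((contDiffAt_gradient hf).fderiv_right (by norm_num)).differentiableAt one_ne_zero).hasFDerivAt

theorem inner_hess_eq_fderiv_fderiv (hf : ContDiffAt ℝ 3 f x) (u v : Vec p) :
    inner ℝ (hess f x u) v = fderiv ℝ (fderiv ℝ f) x u v := by
  have hinner : HasFDerivAt (fun y => inner ℝ v (gradient f y)) ((innerSL ℝ v).comp (hess f x)) x :=
    (innerSL ℝ v).hasFDerivAt.comp x (hasFDerivAt_gradient hf)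
  have happly : HasFDerivAt (fun y => fderiv ℝ f y v)
      ((ContinuousLinearMap.apply ℝ ℝ v).comp (fderiv ℝ (fderiv ℝ f) x)) x :=
    (ContinuousLinearMap.apply ℝ ℝ v).hasFDerivAt.comp x
      ((hf.fderiv_right (m := 2) (by norm_num)).differentiableAt two_ne_zero).hasFDerivAt
  have heq : (fun y => inner ℝ v (gradient f y)) = fun y => fderiv ℝ f y v := by
    funext y
    rw [real_inner_comm, gradient, InnerProductSpace.toDual_symm_apply]
  rw [real_inner_comm]
  exact DFunLike.congr_fun ((heq ▸ hinner).unique happly) u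

theorem inner_hess_comm (hf : ContDiffAt ℝ 3 f x) (u v : Vec p) :
    inner ℝ (hess f x u) v = inner ℝ (hess f x v) u := by
  rw [inner_hess_eq_fderiv_fderiv hf, inner_hess_eq_fderiv_fderiv hf]
  exact hf.isSymmSndFDerivAt (by rw [minSmoothness_of_isRCLikeNormedField]; norm_num) u v

theorem hessForm_isSymm (hf : ContDiffAt ℝ 3 f x) : (hessForm f x).IsSymm :=
  ⟨inner_hess_comm hf⟩

theorem third_comm_left (hf : ContDiffAt ℝ 3 f x) (u v w : Vec p) :
    third f x u v w = third f x v u w :=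
  congrArg (inner ℝ · w) ((contDiffAt_gradient hf).isSymmSndFDerivAt (by simp) u v)

theorem hasDerivAt_inner_hess {u : Vec p} {t : ℝ} (hf : ContDiffAt ℝ 3 f (x + t • u))
    (v w : Vec p) :
    HasDerivAt (fun s : ℝ => inner ℝ (hess f (x + s • u) v) w) (third f (x + t • u) u v w) t := by
  have hline := (hasFDerivAt_hess hf).comp_hasDerivAt t (hasDerivAt_line x u t)
  have happly := (ContinuousLinearMap.apply ℝ (Vec p) v).hasFDerivAt.comp_hasDerivAt t hline
  simpa [Function.comp_def, third, real_inner_comm] using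
    (innerSL ℝ w).hasFDerivAt.comp_hasDerivAt t happly

theorem hasDerivAt_inner_gradient {u : Vec p} {t : ℝ} (hf : ContDiffAt ℝ 3 f (x + t • u))
    (v : Vec p) :
    HasDerivAt (fun s : ℝ => inner ℝ (gradient f (x + s • u)) v)
      (inner ℝ (hess f (x + t • u) u) v) t := by
  have hline := (hasFDerivAt_gradient hf).comp_hasDerivAt t (hasDerivAt_line x u t)
  simpa [Function.comp_def, real_inner_comm] using
    (innerSL ℝ v).hasFDerivAt.comp_hasDerivAt t hline

theorem hasDerivAt_comp_line {u : Vec p} {t : ℝ} (hf : ContDiffAt ℝ 3 f (x + t • u)) :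
    HasDerivAt (fun s : ℝ => f (x + s • u)) (inner ℝ (gradient f (x + t • u)) u) t := by
  simpa [Function.comp_def] using (hf.differentiableAt (by norm_num)).hasGradientAt.hasFDerivAt
    |>.comp_hasDerivAt t (hasDerivAt_line x u t)

theorem third_comm_right (hf : ContDiffAt ℝ 3 f x) (u v w : Vec p) :
    third f x u v w = third f x u w v := by
  have hf₀ : ContDiffAt ℝ 3 f (x + (0 : ℝ) • u) := by simpa using hf
  have hcomm : (fun s : ℝ => inner ℝ (hess f (x + s • u) v) w) =ᶠ[𝓝 0]
      fun s : ℝ => inner ℝ (hess f (x + s • u) w) v :=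
    ((hasDerivAt_line x u 0).continuousAt.eventually (hf₀.eventually (by simp))).mono
      fun s hs => inner_hess_comm hs v w
  simpa using ((hasDerivAt_inner_hess hf₀ v w).congr_of_eventuallyEq hcomm.symm).unique
    (hasDerivAt_inner_hess hf₀ w v)

end Derivatives

/-! ### Local norms -/

section LocalNorm

variable (f : Vec p → ℝ) (x u v : Vec p)

theorem localNorm_nonneg : 0 ≤ localNorm f x u := Real.sqrt_nonneg _

theorem localNorm_smul (c : ℝ) : localNorm f x (c • u) = |c| * localNorm f x u := by
  unfold localNorm
  rw [map_smul, real_inner_smul_left, real_inner_smul_right, ← mul_assoc, ← sq,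
    Real.sqrt_mul (sq_nonneg c), Real.sqrt_sq_eq_abs]

theorem localNorm_neg : localNorm f x (-u) = localNorm f x u := by
  simp [localNorm]

theorem localNorm_sub_rev : localNorm f x (u - v) = localNorm f x (v - u) := by
  rw [← neg_sub, localNorm_neg]

theorem localNorm_zero : localNorm f x 0 = 0 := by simp [localNorm]

end LocalNorm

/-! ### Self-concordant functions -/

/-- A `C³` function on an open convex set `D`, with positive definite Hessian, that satisfies the
self-concordance inequality; unlike for a barrier, nothing is required at the boundary of `D`. -/
structure IsNondegSelfConcordant (D : Set (Vec p)) (f : Vec p → ℝ) : Prop where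
  isOpen : IsOpen D
  convex : Convex ℝ D
  contDiffOn : ContDiffOn ℝ 3 f D
  pos : ∀ x ∈ D, ∀ u : Vec p, u ≠ 0 → 0 < inner ℝ (hess f x u) u
  third_diag : ∀ x ∈ D, ∀ u : Vec p, |third f x u u u| ≤ 2 * localNorm f x u ^ 3

namespace IsNondegSelfConcordant

variable {D : Set (Vec p)} {f : Vec p → ℝ} {x y : Vec p}

theorem contDiffAt (h : IsNondegSelfConcordant D f) (hx : x ∈ D) : ContDiffAt ℝ 3 f x :=
  h.contDiffOn.contDiffAt (h.isOpen.mem_nhds hx)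

theorem inner_hess_nonneg (h : IsNondegSelfConcordant D f) (hx : x ∈ D) (u : Vec p) :
    0 ≤ inner ℝ (hess f x u) u := by
  rcases eq_or_ne u 0 with rfl | hu
  · simp
  · exact (h.pos x hx u hu).le

theorem localNorm_sq (h : IsNondegSelfConcordant D f) (hx : x ∈ D) (u : Vec p) :
    localNorm f x u ^ 2 = inner ℝ (hess f x u) u :=
  Real.sq_sqrt (h.inner_hess_nonneg hx u)

theorem localNorm_pos (h : IsNondegSelfConcordant D f) (hx : x ∈ D) {u : Vec p} (hu : u ≠ 0) :
    0 < localNorm f x u :=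
  Real.sqrt_pos.2 (h.pos x hx u hu)

theorem localNorm_eq_zero (h : IsNondegSelfConcordant D f) (hx : x ∈ D) {u : Vec p}
    (hu : localNorm f x u = 0) : u = 0 := by
  by_contra hne
  exact (h.localNorm_pos hx hne).ne' hu

theorem localNorm_add_sq (h : IsNondegSelfConcordant D f) (hx : x ∈ D) (u v : Vec p) :
    localNorm f x (u + v) ^ 2 =
      localNorm f x u ^ 2 + 2 * inner ℝ (hess f x u) v + localNorm f x v ^ 2 := by
  simp only [h.localNorm_sq hx, map_add, inner_add_left, inner_add_right,
    inner_hess_comm (h.contDiffAt hx) v u]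
  ring

theorem abs_inner_le_of_diag (h : IsNondegSelfConcordant D f) (hx : x ∈ D)
    {A : LinearMap.BilinForm ℝ (Vec p)} {c : ℝ} (hA : A.IsSymm) (hc : 0 ≤ c)
    (hAf : ∀ u, |A u u| ≤ c * localNorm f x u ^ 2) (u v : Vec p) :
    |A u v| ≤ c * localNorm f x u * localNorm f x v := by
  have hsq := sq_apply_le_of_abs_apply_self_le hA (hessForm_isSymm (h.contDiffAt hx))
    (fun w => (hAf w).trans_eq (by rw [h.localNorm_sq hx]; rfl)) u v
  refine abs_le_of_sq_le_sq (hsq.trans_eq ?_)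
    (mul_nonneg (mul_nonneg hc (localNorm_nonneg f x u)) (localNorm_nonneg f x v))
  rw [mul_pow, mul_pow, h.localNorm_sq hx, h.localNorm_sq hx, mul_assoc]
  rfl

theorem abs_inner_hess_le (h : IsNondegSelfConcordant D f) (hx : x ∈ D) (u v : Vec p) :
    |inner ℝ (hess f x u) v| ≤ localNorm f x u * localNorm f x v := by
  have hdiag (w : Vec p) : |hessForm f x w w| ≤ 1 * localNorm f x w ^ 2 := by
    rw [h.localNorm_sq hx, one_mul]
    exact (abs_of_nonneg (h.inner_hess_nonneg hx w)).le
  simpa using! h.abs_inner_le_of_diag hx (hessForm_isSymm (h.contDiffAt hx)) zero_le_one hdiag u v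

theorem localNorm_add_le (h : IsNondegSelfConcordant D f) (hx : x ∈ D) (u v : Vec p) :
    localNorm f x (u + v) ≤ localNorm f x u + localNorm f x v := by
  refine le_of_sq_le_sq ?_ (add_nonneg (localNorm_nonneg _ _ _) (localNorm_nonneg _ _ _))
  rw [h.localNorm_add_sq hx]
  linarith [(abs_le.1 (h.abs_inner_hess_le hx u v)).2,
    add_sq (localNorm f x u) (localNorm f x v)]

theorem abs_third_le (h : IsNondegSelfConcordant D f) (hx : x ∈ D) (u v : Vec p) :
    |third f x u v v| ≤ 2 * localNorm f x u * localNorm f x v ^ 2 := by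
  rw [h.localNorm_sq hx]
  exact abs_trilinear_apply_le_of_abs_apply_self_le (B := hessForm f x)
    (hessForm_isSymm (h.contDiffAt hx)) (h.pos x hx) (third_comm_left (h.contDiffAt hx))
    (third_comm_right (h.contDiffAt hx)) zero_le_two (h.third_diag x hx) u v

theorem abs_inv_localNorm_sub_le (h : IsNondegSelfConcordant D f) {u : Vec p} (hu : u ≠ 0)
    {T : ℝ} (hT : 0 ≤ T) (hline : ∀ t ∈ Icc 0 T, x + t • u ∈ D) :
    |(localNorm f (x + T • u) u)⁻¹ - (localNorm f x u)⁻¹| ≤ T := by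
  have hderiv (t : ℝ) (ht : t ∈ Icc 0 T) := ((hasDerivAt_inner_hess
    (h.contDiffAt (hline t ht)) u u).sqrt (h.pos _ (hline t ht) u hu).ne').inv
      (h.localNorm_pos (hline t ht) hu).ne'
  have hle := abs_sub_le_sub_of_abs_hasDerivAt_le hT hderiv (fun t _ => hasDerivAt_id t)
    fun t ht => by
      have hpos := h.localNorm_pos (hline t ht) hu
      have hthird := h.third_diag _ (hline t ht) u
      change |-(third f (x + t • u) u u u / (2 * localNorm f (x + t • u) u)) /
        localNorm f (x + t • u) u ^ 2| ≤ 1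
      rw [abs_div, abs_neg, abs_div, abs_of_pos (mul_pos two_pos hpos), abs_of_pos (pow_pos hpos 2),
        div_div, div_le_one (by positivity)]
      linarith
  simpa [localNorm] using hle

theorem localNorm_line_le (h : IsNondegSelfConcordant D f) {u : Vec p} {t : ℝ} (ht : 0 ≤ t)
    (hline : ∀ s ∈ Icc 0 t, x + s • u ∈ D) (hr : t * localNorm f x u < 1) :
    localNorm f (x + t • u) u ≤ localNorm f x u / (1 - t * localNorm f x u) := by
  rcases eq_or_ne u 0 with rfl | hu
  · simp [localNorm_zero]
  have hx := h.localNorm_pos (by simpa using hline 0 (left_mem_Icc.2 ht)) hu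
  have hxt := h.localNorm_pos (hline t (right_mem_Icc.2 ht)) hu
  have hinv := (abs_le.1 (h.abs_inv_localNorm_sub_le hu ht hline)).1
  rw [le_div_iff₀ (by linarith)]
  field_simp at hinv
  linarith

theorem le_localNorm_line (h : IsNondegSelfConcordant D f) {u : Vec p} {t : ℝ} (ht : 0 ≤ t)
    (hline : ∀ s ∈ Icc 0 t, x + s • u ∈ D) :
    localNorm f x u / (1 + t * localNorm f x u) ≤ localNorm f (x + t • u) u := by
  rcases eq_or_ne u 0 with rfl | hu
  · simp [localNorm_zero]
  have hx := h.localNorm_pos (by simpa using hline 0 (left_mem_Icc.2 ht)) hu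
  have hxt := h.localNorm_pos (hline t (right_mem_Icc.2 ht)) hu
  have hinv := (abs_le.1 (h.abs_inv_localNorm_sub_le hu ht hline)).2
  rw [div_le_iff₀ (by positivity)]
  field_simp at hinv
  linarith

theorem le_inner_gradient_sub (h : IsNondegSelfConcordant D f) (hx : x ∈ D) (hy : y ∈ D) :
    localNorm f x (y - x) ^ 2 / (1 + localNorm f x (y - x)) ≤
      inner ℝ (gradient f y - gradient f x) (y - x) := by
  obtain ⟨u, rfl⟩ : ∃ u, y = x + u := ⟨y - x, by abel⟩
  have hline (t : ℝ) (ht : t ∈ Icc (0 : ℝ) 1) : x + t • u ∈ D := h.convex.add_smul_mem hx hy ht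
  have hr := localNorm_nonneg f x u
  have hpos (t : ℝ) (ht : t ∈ Icc (0 : ℝ) 1) : 0 < 1 + t * localNorm f x u := by
    have := mul_nonneg ht.1 hr
    linarith
  have hle := sub_le_sub_of_hasDerivAt_le zero_le_one
    (fun t ht => ((hasDerivAt_inv_one_sub (-localNorm f x u) (t := t)
      (by linarith [hpos t ht])).const_mul (localNorm f x u)).neg)
    (fun t ht => hasDerivAt_inner_gradient (h.contDiffAt (hline t ht)) u) fun t ht => by
      have hnorm := h.le_localNorm_line ht.1 fun s hs => hline s ⟨hs.1, hs.2.trans ht.2⟩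
      have := hpos t ht
      rw [← h.localNorm_sq (hline t ht)]
      refine le_trans (le_of_eq ?_) (pow_le_pow_left₀ (by positivity) hnorm 2)
      rw [mul_neg, sub_neg_eq_add, div_pow]
      ring
  simp only [Pi.neg_apply, one_smul, zero_smul, add_zero, one_mul, zero_mul, sub_zero,
    sub_neg_eq_add, inv_one, mul_one] at hle
  rw [add_sub_cancel_left, inner_sub_left]
  refine le_trans (le_of_eq ?_) hle
  field_simp
  ring

theorem add_inner_gradient_add_le (h : IsNondegSelfConcordant D f) (hx : x ∈ D) (hy : y ∈ D) :
    f x + inner ℝ (gradient f x) (y - x) +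
      (localNorm f x (y - x) - Real.log (1 + localNorm f x (y - x))) ≤ f y := by
  obtain ⟨u, rfl⟩ : ∃ u, y = x + u := ⟨y - x, by abel⟩
  have hline (t : ℝ) (ht : t ∈ Icc (0 : ℝ) 1) : x + t • u ∈ D := h.convex.add_smul_mem hx hy ht
  have hr := localNorm_nonneg f x u
  have hpos (t : ℝ) (ht : t ∈ Icc (0 : ℝ) 1) : 0 < 1 + t * localNorm f x u := by
    have := mul_nonneg ht.1 hr
    linarith
  have hlin (c t : ℝ) : HasDerivAt (fun s : ℝ => s * c) c t := by
    simpa using (hasDerivAt_id t).mul_const c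
  have hle := sub_le_sub_of_hasDerivAt_le zero_le_one
    (fun t ht => (hlin (inner ℝ (gradient f x) u + localNorm f x u) t).sub
      (((hlin (localNorm f x u) t).const_add 1).log (hpos t ht).ne'))
    (fun t ht => hasDerivAt_comp_line (h.contDiffAt (hline t ht))) fun t ht => by
      rcases ht.1.eq_or_lt with rfl | ht₀
      · simp
      have hmono := h.le_inner_gradient_sub hx (hline t ht)
      rw [add_sub_cancel_left, localNorm_smul, abs_of_pos ht₀, real_inner_smul_right,
        inner_sub_left, mul_pow, sq, mul_assoc, mul_div_assoc,
        mul_le_mul_iff_of_pos_left ht₀] at hmono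
      have := hpos t ht
      refine le_trans (le_of_eq ?_) (add_le_of_le_sub_left hmono)
      field_simp
      ring
  simp only [Pi.sub_apply, one_smul, zero_smul, add_zero, one_mul, zero_mul, sub_zero,
    Real.log_one] at hle
  rw [add_sub_cancel_left]
  linarith

theorem add_inner_gradient_le (h : IsNondegSelfConcordant D f) (hx : x ∈ D) (hy : y ∈ D) :
    f x + inner ℝ (gradient f x) (y - x) ≤ f y := by
  have hr := localNorm_nonneg f x (y - x)
  have hlog := Real.log_le_sub_one_of_pos (by linarith : 0 < 1 + localNorm f x (y - x))
  linarith [h.add_inner_gradient_add_le hx hy]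

theorem abs_log_localNorm_sub_log_localNorm_le (h : IsNondegSelfConcordant D f) (hx : x ∈ D)
    (hy : y ∈ D) (hr : localNorm f x (y - x) < 1) {v : Vec p} (hv : v ≠ 0) :
    |Real.log (localNorm f y v) - Real.log (localNorm f x v)| ≤
      -Real.log (1 - localNorm f x (y - x)) := by
  obtain ⟨u, rfl⟩ : ∃ u, y = x + u := ⟨y - x, by abel⟩
  rw [add_sub_cancel_left] at hr ⊢
  have hline (t : ℝ) (ht : t ∈ Icc (0 : ℝ) 1) : x + t • u ∈ D := h.convex.add_smul_mem hx hy ht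
  have hpos (t : ℝ) (ht : t ∈ Icc (0 : ℝ) 1) : 0 < 1 - t * localNorm f x u := by
    linarith [mul_le_of_le_one_left (localNorm_nonneg f x u) ht.2]
  have hderiv (t : ℝ) (ht : t ∈ Icc (0 : ℝ) 1) := ((hasDerivAt_inner_hess
    (h.contDiffAt (hline t ht)) v v).sqrt (h.pos _ (hline t ht) v hv).ne').log
      (h.localNorm_pos (hline t ht) hv).ne'
  have hle := abs_sub_le_sub_of_abs_hasDerivAt_le zero_le_one hderiv
    (fun t ht => ((((hasDerivAt_id t).mul_const (localNorm f x u)).const_sub 1).log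
      (hpos t ht).ne').neg) fun t ht => by
      have hnorm := h.localNorm_pos (hline t ht) hv
      have hthird := h.abs_third_le (hline t ht) u v
      have hu := h.localNorm_line_le ht.1 (fun s hs => hline s ⟨hs.1, hs.2.trans ht.2⟩)
        (by linarith [hpos t ht])
      change |third f (x + t • u) u v v / (2 * localNorm f (x + t • u) v) /
        localNorm f (x + t • u) v| ≤ _
      rw [div_div, abs_div, abs_of_pos (by positivity : 0 < 2 * localNorm f (x + t • u) v *
        localNorm f (x + t • u) v), div_le_iff₀ (by positivity)]
      calc |third f (x + t • u) u v v|
          ≤ localNorm f (x + t • u) u * (2 * localNorm f (x + t • u) v *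
            localNorm f (x + t • u) v) := by linarith
        _ ≤ localNorm f x u / (1 - t * localNorm f x u) * (2 * localNorm f (x + t • u) v *
            localNorm f (x + t • u) v) := by gcongr
        _ = _ := by simp [neg_div]
  simpa [localNorm] using hle

theorem localNorm_le_div (h : IsNondegSelfConcordant D f) (hx : x ∈ D) (hy : y ∈ D)
    (hr : localNorm f x (y - x) < 1) (v : Vec p) :
    localNorm f y v ≤ localNorm f x v / (1 - localNorm f x (y - x)) := by
  rcases eq_or_ne v 0 with rfl | hv
  · simp [localNorm_zero]
  have hlog := (abs_le.1 (h.abs_log_localNorm_sub_log_localNorm_le hx hy hr hv)).2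
  have hxv := h.localNorm_pos hx hv
  rw [← Real.log_le_log_iff (h.localNorm_pos hy hv) (div_pos hxv (sub_pos.2 hr)),
    Real.log_div hxv.ne' (sub_pos.2 hr).ne']
  linarith

theorem mul_localNorm_le (h : IsNondegSelfConcordant D f) (hx : x ∈ D) (hy : y ∈ D)
    (hr : localNorm f x (y - x) < 1) (v : Vec p) :
    (1 - localNorm f x (y - x)) * localNorm f x v ≤ localNorm f y v := by
  rcases eq_or_ne v 0 with rfl | hv
  · simp [localNorm_zero]
  have hlog := (abs_le.1 (h.abs_log_localNorm_sub_log_localNorm_le hx hy hr hv)).1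
  have hxv := h.localNorm_pos hx hv
  rw [← Real.log_le_log_iff (mul_pos (sub_pos.2 hr) hxv) (h.localNorm_pos hy hv),
    Real.log_mul (sub_pos.2 hr).ne' hxv.ne']
  linarith

theorem abs_inner_hess_sub_le (h : IsNondegSelfConcordant D f) (hx : x ∈ D) (hy : y ∈ D)
    (hr : localNorm f x (y - x) < 1) (u v : Vec p) :
    |inner ℝ (hess f y u) v - inner ℝ (hess f x u) v| ≤
      (((1 - localNorm f x (y - x)) ^ 2)⁻¹ - 1) * localNorm f x u * localNorm f x v := by
  have hs : 0 < 1 - localNorm f x (y - x) := sub_pos.2 hr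
  have hs₁ : 1 - localNorm f x (y - x) ≤ 1 := sub_le_self _ (localNorm_nonneg f x _)
  refine h.abs_inner_le_of_diag hx (A := hessForm f y - hessForm f x)
    ((hessForm_isSymm (h.contDiffAt hy)).sub (hessForm_isSymm (h.contDiffAt hx)))
    (sub_nonneg.2 (one_le_inv₀ (by positivity) |>.2 (pow_le_one₀ hs.le hs₁))) (fun w => ?_) u v
  have hup := pow_le_pow_left₀ (localNorm_nonneg f y w) (h.localNorm_le_div hx hy hr w) 2
  have hlow := pow_le_pow_left₀ (mul_nonneg hs.le (localNorm_nonneg f x w))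
    (h.mul_localNorm_le hx hy hr w) 2
  have hinv : 2 - (1 - localNorm f x (y - x)) ^ 2 ≤ ((1 - localNorm f x (y - x)) ^ 2)⁻¹ := by
    rw [← sub_nonneg, show ((1 - localNorm f x (y - x)) ^ 2)⁻¹
      - (2 - (1 - localNorm f x (y - x)) ^ 2) = ((1 - localNorm f x (y - x)) ^ 2 - 1) ^ 2 /
        (1 - localNorm f x (y - x)) ^ 2 by field_simp; ring]
    positivity
  have hinv_mul := mul_le_mul_of_nonneg_right hinv (sq_nonneg (localNorm f x w))
  rw [div_pow, div_eq_mul_inv] at hup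
  rw [mul_pow] at hlow
  change |inner ℝ (hess f y w) w - inner ℝ (hess f x w) w| ≤ _
  rw [← h.localNorm_sq hx, ← h.localNorm_sq hy]
  exact abs_le.2 ⟨by linarith, by linarith⟩

theorem abs_inner_gradient_sub_sub_hess_le (h : IsNondegSelfConcordant D f) (hx : x ∈ D)
    (hy : y ∈ D) (hr : localNorm f x (y - x) < 1) (v : Vec p) :
    |inner ℝ (gradient f y - gradient f x - hess f x (y - x)) v| ≤
      localNorm f x (y - x) ^ 2 / (1 - localNorm f x (y - x)) * localNorm f x v := by
  obtain ⟨u, rfl⟩ : ∃ u, y = x + u := ⟨y - x, by abel⟩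
  rw [add_sub_cancel_left] at hr ⊢
  have hline (t : ℝ) (ht : t ∈ Icc (0 : ℝ) 1) : x + t • u ∈ D := h.convex.add_smul_mem hx hy ht
  have hnorm (t : ℝ) (ht : t ∈ Icc (0 : ℝ) 1) :
      localNorm f x (x + t • u - x) = t * localNorm f x u := by
    rw [add_sub_cancel_left, localNorm_smul, abs_of_nonneg ht.1]
  have hlt (t : ℝ) (ht : t ∈ Icc (0 : ℝ) 1) : t * localNorm f x u < 1 :=
    (mul_le_of_le_one_left (localNorm_nonneg f x u) ht.2).trans_lt hr
  have hlin (c t : ℝ) : HasDerivAt (fun s : ℝ => s * c) c t := by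
    simpa using (hasDerivAt_id t).mul_const c
  have hle := abs_sub_le_sub_of_abs_hasDerivAt_le zero_le_one
    (fun t ht => (hasDerivAt_inner_gradient (h.contDiffAt (hline t ht)) v).sub
      (hlin (inner ℝ (hess f x u) v) t))
    (fun t ht => ((hasDerivAt_inv_one_sub _ (sub_pos.2 (hlt t ht)).ne').sub
      (hlin (localNorm f x u) t)).mul_const (localNorm f x v)) fun t ht => by
      have hdiff := h.abs_inner_hess_sub_le hx (hline t ht) (by rw [hnorm t ht]; exact hlt t ht) u v
      rw [hnorm t ht] at hdiff
      exact hdiff.trans_eq (by ring)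
  simp only [Pi.sub_apply, one_smul, zero_smul, add_zero, one_mul, zero_mul, sub_zero,
    inv_one] at hle
  rw [inner_sub_left, inner_sub_left]
  convert hle using 1
  · ring_nf
  · have := (sub_pos.2 hr).ne'
    field_simp
    ring

theorem le_add_inner_gradient_add (h : IsNondegSelfConcordant D f) (hx : x ∈ D) (hy : y ∈ D)
    (hr : localNorm f x (y - x) < 1) :
    f y ≤ f x + inner ℝ (gradient f x) (y - x) +
      localNorm f x (y - x) ^ 2 / (1 - localNorm f x (y - x)) := by
  have hconv := h.add_inner_gradient_le hy hx
  have hgrad := (abs_le.1 (h.abs_inner_gradient_sub_sub_hess_le hx hy hr (y - x))).2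
  rw [← neg_sub y x, inner_neg_right] at hconv
  rw [inner_sub_left, inner_sub_left, ← h.localNorm_sq hx] at hgrad
  have hsum : localNorm f x (y - x) ^ 2 + localNorm f x (y - x) ^ 2 /
      (1 - localNorm f x (y - x)) * localNorm f x (y - x) =
      localNorm f x (y - x) ^ 2 / (1 - localNorm f x (y - x)) := by
    have := (sub_pos.2 hr).ne'
    field_simp
    ring
  linarith

theorem gradient_eq_zero (h : IsNondegSelfConcordant D f) (hx : x ∈ D)
    (hmin : ∀ y ∈ D, f x ≤ f y) : gradient f x = 0 := by
  have hlocal : IsLocalMin f x := Filter.mem_of_superset (h.isOpen.mem_nhds hx) hmin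
  rw [gradient, hlocal.fderiv_eq_zero, map_zero]

end IsNondegSelfConcordant

/-! ### Barriers -/

theorem isClosed_inter_setOf_le {E : Type*} [TopologicalSpace E] {D : Set E} {f : E → ℝ}
    (hf : ContinuousOn f D) (hblow : ∀ y ∉ D, Tendsto f (𝓝[D] y) atTop) (M : ℝ) :
    IsClosed (D ∩ {y | f y ≤ M}) := by
  refine isClosed_of_closure_subset fun y hy => ?_
  have hbot := mem_closure_iff_nhdsWithin_neBot.1 hy
  have hle : ∀ᶠ z in 𝓝[D ∩ {y | f y ≤ M}] y, f z ≤ M :=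
    eventually_nhdsWithin_of_forall fun z hz => hz.2
  have hmono : 𝓝[D ∩ {y | f y ≤ M}] y ≤ 𝓝[D] y := nhdsWithin_mono y inter_subset_left
  by_cases hyD : y ∈ D
  · exact ⟨hyD, le_of_tendsto ((hf y hyD).mono_left hmono) hle⟩
  · obtain ⟨z, hz, hz'⟩ :=
      ((((hblow y hyD).mono_left hmono).eventually_gt_atTop M).and hle).exists
    exact absurd hz' (not_le.2 hz)

theorem add_mem_of_forall_le {E : Type*} [AddCommGroup E] [Module ℝ E] [TopologicalSpace E]
    [ContinuousAdd E] [ContinuousSMul ℝ E] {D : Set E} {f : E → ℝ} (hD : IsOpen D)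
    (hf : ContinuousOn f D) (hblow : ∀ y ∉ D, Tendsto f (𝓝[D] y) atTop) {x u : E} (hx : x ∈ D)
    {M : ℝ} (hM : ∀ t ∈ Icc (0 : ℝ) 1, x + t • u ∈ D → f (x + t • u) ≤ M) : x + u ∈ D := by
  have hline : Continuous fun t : ℝ => x + t • u := by fun_prop
  have hclosed : IsClosed ((fun t : ℝ => x + t • u) ⁻¹' D ∩ Icc 0 1) := by
    have heq : (fun t : ℝ => x + t • u) ⁻¹' D ∩ Icc 0 1 =
        (fun t : ℝ => x + t • u) ⁻¹' (D ∩ {y | f y ≤ M}) ∩ Icc 0 1 := by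
      ext t
      exact ⟨fun ht => ⟨⟨ht.1, hM t ht.2 ht.1⟩, ht.2⟩, fun ht => ⟨ht.1.1, ht.2⟩⟩
    rw [heq]
    exact ((isClosed_inter_setOf_le hf hblow M).preimage hline).inter isClosed_Icc
  simpa using! hclosed.Icc_subset_of_forall_mem_nhdsWithin (by simpa using hx)
    (fun t ht => mem_nhdsWithin_of_mem_nhds ((hD.preimage hline).mem_nhds ht.1))
    (right_mem_Icc.2 zero_le_one)

theorem localNorm_le_mul_of_forall_lt_one {f : Vec p → ℝ} {a z : Vec p} {c : ℝ}
    (h : ∀ u, localNorm f a u < 1 → localNorm f z u ≤ c) (u : Vec p) :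
    localNorm f z u ≤ c * localNorm f a u := by
  have hgt (r : ℝ) (hr : localNorm f a u < r) : localNorm f z u ≤ c * r := by
    have hr₀ : 0 < r := (localNorm_nonneg f a u).trans_lt hr
    have hscaled := h (r⁻¹ • u) (by
      rwa [localNorm_smul, abs_inv, abs_of_pos hr₀, inv_mul_lt_iff₀ hr₀, mul_one])
    rwa [localNorm_smul, abs_inv, abs_of_pos hr₀, inv_mul_le_iff₀ hr₀, mul_comm] at hscaled
  have hcont : Tendsto (fun r => c * r) (𝓝[>] localNorm f a u) (𝓝 (c * localNorm f a u)) :=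
    (tendsto_id.const_mul c).mono_left nhdsWithin_le_nhds
  exact ge_of_tendsto hcont (eventually_nhdsWithin_of_forall hgt)

namespace IsNondegSelfConcordant

variable {D : Set (Vec p)} {f : Vec p → ℝ} {s : ℝ} {x y z : Vec p}

theorem add_mem_of_localNorm_lt_one (h : IsNondegSelfConcordant D f)
    (hblow : ∀ y ∉ D, Tendsto f (𝓝[D] y) atTop) {u : Vec p} (hx : x ∈ D)
    (hr : localNorm f x u < 1) : x + u ∈ D := by
  refine add_mem_of_forall_le (M := f x + |inner ℝ (gradient f x) u| +
    localNorm f x u ^ 2 / (1 - localNorm f x u)) h.isOpen h.contDiffOn.continuousOn hblow hx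
    fun t ht hxt => ?_
  have htr : t * localNorm f x u ≤ localNorm f x u :=
    mul_le_of_le_one_left (localNorm_nonneg f x u) ht.2
  have hinner : t * inner ℝ (gradient f x) u ≤ |inner ℝ (gradient f x) u| :=
    (le_abs_self _).trans (by
      rw [abs_mul, abs_of_nonneg ht.1]
      exact mul_le_of_le_one_left (abs_nonneg _) ht.2)
  have hnorm : localNorm f x (x + t • u - x) = t * localNorm f x u := by
    rw [add_sub_cancel_left, localNorm_smul, abs_of_nonneg ht.1]
  have hle := h.le_add_inner_gradient_add hx hxt (by rw [hnorm]; exact htr.trans_lt hr)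
  rw [hnorm, add_sub_cancel_left, real_inner_smul_right] at hle
  have hfrac : (t * localNorm f x u) ^ 2 / (1 - t * localNorm f x u) ≤
      localNorm f x u ^ 2 / (1 - localNorm f x u) := by
    have := mul_nonneg ht.1 (localNorm_nonneg f x u)
    have := sub_pos.2 hr
    gcongr
  linarith

theorem inner_gradient_le_inner_gradient_add (h : IsNondegSelfConcordant D f) (hx : x ∈ D)
    {u : Vec p} (hxu : x + u ∈ D) : inner ℝ (gradient f x) u ≤ inner ℝ (gradient f (x + u)) u := by
  have hle := h.le_inner_gradient_sub hx hxu
  have hr := localNorm_nonneg f x u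
  rw [add_sub_cancel_left, inner_sub_left] at hle
  have : 0 ≤ localNorm f x u ^ 2 / (1 + localNorm f x u) := by positivity
  linarith

/-- Along the segment from `x` to `y` the function `t ↦ ⟨∇f(x + t(y - x)), y - x⟩` satisfies
`s²φ' ≥ φ²`, so a value of `φ(0)` above `s²` would make it blow up before time `1`. -/
theorem inner_gradient_le_sq (h : IsNondegSelfConcordant D f) (hs : 0 < s)
    (hgrad : ∀ x ∈ D, ∀ u, inner ℝ (gradient f x) u ≤ s * localNorm f x u) (hx : x ∈ D)
    (hy : y ∈ D) : inner ℝ (gradient f x) (y - x) ≤ s ^ 2 := by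
  obtain ⟨u, rfl⟩ : ∃ u, y = x + u := ⟨y - x, by abel⟩
  rw [add_sub_cancel_left]
  have hline (t : ℝ) (ht : t ∈ Icc (0 : ℝ) 1) : x + t • u ∈ D := h.convex.add_smul_mem hx hy ht
  by_contra! hlt
  have hpos (t : ℝ) (ht : t ∈ Icc (0 : ℝ) 1) : 0 < inner ℝ (gradient f (x + t • u)) u := by
    rcases ht.1.eq_or_lt with rfl | ht₀
    · simpa using (pow_pos hs 2).trans hlt
    · have hmono := h.inner_gradient_le_inner_gradient_add hx (hline t ht)
      rw [real_inner_smul_right, real_inner_smul_right, mul_le_mul_iff_of_pos_left ht₀] at hmono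
      exact ((pow_pos hs 2).trans hlt).trans_le hmono
  have hle := sub_le_sub_of_hasDerivAt_le zero_le_one
    (fun t ht => (hasDerivAt_inner_gradient (h.contDiffAt (hline t ht)) u).inv (hpos t ht).ne')
    (fun t _ => (hasDerivAt_id t).mul_const (-(s ^ 2)⁻¹)) fun t ht => by
      have hsq := pow_le_pow_left₀ (hpos t ht).le (hgrad _ (hline t ht) u) 2
      rw [mul_pow, h.localNorm_sq (hline t ht)] at hsq
      rw [div_le_iff₀ (pow_pos (hpos t ht) 2), one_mul, neg_mul, neg_le_neg_iff,
        inv_mul_le_iff₀ (pow_pos hs 2)]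
      exact hsq
  simp only [Pi.inv_apply, one_smul, zero_smul, add_zero, id_eq, one_mul, zero_mul,
    sub_zero] at hle
  have hinv₁ := inv_pos.2 (hpos 1 (right_mem_Icc.2 zero_le_one))
  have hinv₀ := inv_strictAnti₀ (pow_pos hs 2) hlt
  rw [one_smul] at hinv₁
  linarith

theorem localNorm_sub_le_of_gradient_eq_zero (h : IsNondegSelfConcordant D f) (hs : 0 < s)
    (hgrad : ∀ x ∈ D, ∀ u, inner ℝ (gradient f x) u ≤ s * localNorm f x u) (hz : z ∈ D)
    (hz₀ : gradient f z = 0) (hy : y ∈ D) : localNorm f z (y - z) ≤ s ^ 2 + 2 * s := by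
  obtain ⟨u, rfl⟩ : ∃ u, y = z + u := ⟨y - z, by abel⟩
  rw [add_sub_cancel_left]
  rcases le_or_gt (localNorm f z u) s with hle | hlt
  · linarith [pow_pos hs 2]
  have hr := hs.trans hlt
  -- the two estimates are compared at the point of the segment at local distance `s` from `z`
  obtain ⟨α, hα, hα₁, hαr⟩ : ∃ α : ℝ, 0 < α ∧ α ≤ 1 ∧ α * localNorm f z u = s :=
    ⟨s / localNorm f z u, div_pos hs hr, (div_le_one hr).2 hlt.le, div_mul_cancel₀ _ hr.ne'⟩
  have hm : z + α • u ∈ D := h.convex.add_smul_mem hz hy ⟨hα.le, hα₁⟩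
  have hlow := h.le_inner_gradient_sub hz hm
  have hup := h.inner_gradient_le_sq hs hgrad hm hy
  rw [add_sub_cancel_left, localNorm_smul, abs_of_pos hα, hαr, hz₀, sub_zero,
    real_inner_smul_right, div_le_iff₀ (by positivity)] at hlow
  rw [show z + u - (z + α • u) = (1 - α) • u by module, real_inner_smul_right] at hup
  generalize inner ℝ (gradient f (z + α • u)) u = P at hlow hup
  generalize localNorm f z u = r at *
  have hP : (1 - α) * s ^ 2 ≤ s ^ 2 * (α * (1 + s)) := calc
    (1 - α) * s ^ 2 ≤ (1 - α) * (α * P * (1 + s)) :=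
      mul_le_mul_of_nonneg_left hlow (sub_nonneg.2 hα₁)
    _ = (1 - α) * P * (α * (1 + s)) := by ring
    _ ≤ s ^ 2 * (α * (1 + s)) := by gcongr
  have hα_le : 1 - α ≤ α * (1 + s) := by
    refine le_of_mul_le_mul_left ?_ (pow_pos hs 2)
    linarith
  calc r ≤ (α * (1 + s) + α) * r := le_mul_of_one_le_left hr.le (by linarith)
    _ = α * r * (1 + s) + α * r := by ring
    _ = s ^ 2 + 2 * s := by rw [hαr]; ring

theorem localNorm_le_of_gradient_eq_zero (h : IsNondegSelfConcordant D f)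
    (hblow : ∀ y ∉ D, Tendsto f (𝓝[D] y) atTop) (hs : 0 < s)
    (hgrad : ∀ x ∈ D, ∀ u, inner ℝ (gradient f x) u ≤ s * localNorm f x u) (hz : z ∈ D)
    (hz₀ : gradient f z = 0) (hx : x ∈ D) (u : Vec p) :
    localNorm f z u ≤ (s ^ 2 + 2 * s) * localNorm f x u := by
  refine localNorm_le_mul_of_forall_lt_one (fun w hw => ?_) u
  have hpos := h.localNorm_sub_le_of_gradient_eq_zero hs hgrad hz hz₀
    (h.add_mem_of_localNorm_lt_one hblow hx hw)
  have hneg := h.localNorm_sub_le_of_gradient_eq_zero hs hgrad hz hz₀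
    (h.add_mem_of_localNorm_lt_one hblow hx (u := -w) (by rwa [localNorm_neg]))
  have hadd := h.localNorm_add_le hz (x + w - z) (-(x + -w - z))
  rw [show x + w - z + -(x + -w - z) = (2 : ℝ) • w by module, localNorm_smul, localNorm_neg,
    abs_of_pos two_pos] at hadd
  linarith

theorem hess_inverse_apply (h : IsNondegSelfConcordant D f) (hx : x ∈ D) (v : Vec p) :
    hess f x ((hess f x).inverse v) = v := by
  have hinj : Function.Injective (hess f x) := by
    rw [injective_iff_map_eq_zero]
    intro w hw
    by_contra hne
    simpa [hw] using h.pos x hx w hne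
  let e : Vec p ≃L[ℝ] Vec p :=
    (LinearEquiv.ofInjectiveEndo (hess f x).toLinearMap hinj).toContinuousLinearEquiv
  have he : (e : Vec p →L[ℝ] Vec p) = hess f x := rfl
  rw [← he, ContinuousLinearMap.inverse_equiv]
  simp

theorem inner_le_dualLocalNorm_mul (h : IsNondegSelfConcordant D f) (hx : x ∈ D)
    (v u : Vec p) : inner ℝ v u ≤ dualLocalNorm f x v * localNorm f x u := by
  have hle := (abs_le.1 (h.abs_inner_hess_le hx ((hess f x).inverse v) u)).2
  rwa [localNorm, h.hess_inverse_apply hx, real_inner_comm ((hess f x).inverse v)] at hle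

end IsNondegSelfConcordant

section Barrier

variable {X : Set (Vec p)} {f : Vec p → ℝ} {ν : ℝ} {x z ξ : Vec p}

theorem IsSelfConcordantBarrier.isNondegSelfConcordant (hf : IsSelfConcordantBarrier X f ν)
    (hpd : ∀ x ∈ interior X, ∀ u : Vec p, u ≠ 0 → 0 < inner ℝ (hess f x u) u) :
    IsNondegSelfConcordant (interior X) f where
  isOpen := isOpen_interior
  convex := hf.convex.interior
  contDiffOn := hf.selfConcordant.contDiffOn
  pos := hpd
  third_diag x hx u := by
    have hnonneg : 0 ≤ inner ℝ (hess f x u) u := by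
      rcases eq_or_ne u 0 with rfl | hu
      · simp
      · exact (hpd x hx u hu).le
    refine (hf.selfConcordant.third_le x hx u).trans_eq ?_
    rw [localNorm, Real.sqrt_eq_rpow, ← Real.rpow_natCast, ← Real.rpow_mul hnonneg]
    norm_num

theorem IsSelfConcordantBarrier.tendsto_atTop (hf : IsSelfConcordantBarrier X f ν)
    (hx : x ∉ interior X) : Tendsto f (𝓝[interior X] x) atTop := by
  by_cases hcl : x ∈ closure (interior X)
  · exact hf.tendsto_boundary x ⟨closure_mono interior_subset hcl, hx⟩
  · rw [notMem_closure_iff_nhdsWithin_eq_bot.1 hcl]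
    exact tendsto_bot

theorem IsSelfConcordantBarrier.inner_gradient_le (hf : IsSelfConcordantBarrier X f ν)
    (hpd : ∀ x ∈ interior X, ∀ u : Vec p, u ≠ 0 → 0 < inner ℝ (hess f x u) u)
    (hx : x ∈ interior X) (u : Vec p) : inner ℝ (gradient f x) u ≤ √ν * localNorm f x u := by
  rcases eq_or_ne u 0 with rfl | hu
  · simp [localNorm_zero]
  have hnorm := (hf.isNondegSelfConcordant hpd).localNorm_pos hx hu
  have hν : 0 ≤ ν := zero_le_one.trans hf.one_le
  -- the scaling of `u` maximizing the quadratic in the definition of a barrier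
  have hsup := hf.sup_le x hx ((inner ℝ (gradient f x) u / localNorm f x u ^ 2) • u)
  rw [localNorm_smul, mul_pow, sq_abs, real_inner_smul_right] at hsup
  refine (abs_le_of_sq_le_sq' ?_ (by positivity)).2
  rw [mul_pow, Real.sq_sqrt hν, ← div_le_iff₀ (by positivity)]
  refine le_trans (le_of_eq ?_) hsup
  field_simp
  ring

theorem theta_nonneg (X : Set (Vec p)) (f : Vec p → ℝ) (hν : 0 ≤ ν) : 0 ≤ theta X f ν := by
  unfold theta
  split_ifs <;> positivity

theorem cbar_nonneg (X : Set (Vec p)) (f : Vec p → ℝ) (hν : 0 ≤ ν) (ξ : Vec p) :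
    0 ≤ cbar X f ν ξ := by
  unfold cbar
  split_ifs
  · exact mul_nonneg (theta_nonneg X f hν) (Real.sqrt_nonneg _)
  · exact le_rfl

theorem isArgmin_argmin {Φ : Vec p → EReal} (h : ∃ x, IsArgmin Φ x) : IsArgmin Φ (argmin Φ) := by
  rw [argmin, dif_pos h]
  exact h.choose_spec

theorem isArgmin_iff_of_eq_coe {Φ : Vec p → EReal} {S : Set (Vec p)} {φ : Vec p → ℝ}
    (hS : ∀ y ∈ S, Φ y = φ y) (htop : ∀ y ∉ S, Φ y = ⊤) :
    IsArgmin Φ x ↔ x ∈ S ∧ ∀ y ∈ S, φ x ≤ φ y := by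
  constructor
  · rintro ⟨hne, hmin⟩
    have hx : x ∈ S := of_not_not fun hx => hne (htop x hx)
    refine ⟨hx, fun y hy => ?_⟩
    rw [← EReal.coe_le_coe_iff, ← hS x hx, ← hS y hy]
    exact hmin y
  · rintro ⟨hx, hmin⟩
    refine ⟨by simp [hS x hx], fun y => ?_⟩
    by_cases hy : y ∈ S
    · rw [hS x hx, hS y hy, EReal.coe_le_coe_iff]
      exact hmin y hy
    · exact le_top.trans_eq (htop y hy).symm

theorem isAnalyticCenter_iff :
    IsAnalyticCenter X f z ↔ z ∈ interior X ∧ ∀ y ∈ interior X, f z ≤ f y :=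
  isArgmin_iff_of_eq_coe (fun _ hy => if_pos hy) fun _ hy => if_neg hy

theorem IsAnalyticCenter.not_isLogHomogeneous (hz : IsAnalyticCenter X f z) (hν : 0 < ν) :
    ¬ IsLogHomogeneous X f ν := by
  intro hlog
  obtain ⟨hzX, hmin⟩ := isAnalyticCenter_iff.1 hz
  obtain ⟨hmem, heq⟩ := hlog z hzX 2 two_pos
  linarith [hmin _ hmem, mul_pos hν (Real.log_pos one_lt_two)]

theorem IsSelfConcordantBarrier.inner_le_cbar_mul (hf : IsSelfConcordantBarrier X f ν)
    (hpd : ∀ x ∈ interior X, ∀ u : Vec p, u ≠ 0 → 0 < inner ℝ (hess f x u) u)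
    (hcenter : (∃ z, IsAnalyticCenter X f z) ∨ ξ = 0) (hx : x ∈ interior X) (u : Vec p) :
    inner ℝ ξ u ≤ cbar X f ν ξ * localNorm f x u := by
  have h := hf.isNondegSelfConcordant hpd
  have hν : 0 < ν := zero_lt_one.trans_le hf.one_le
  rcases eq_or_ne ξ 0 with rfl | hξ
  · rw [inner_zero_left]
    exact mul_nonneg (cbar_nonneg X f hν.le _) (localNorm_nonneg f x u)
  have hex := hcenter.resolve_right hξ
  have hz : IsAnalyticCenter X f (argmin (extendTop X f)) := isArgmin_argmin hex
  rw [cbar, if_pos hex, theta, if_neg (hz.not_isLogHomogeneous hν)]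
  generalize argmin (extendTop X f) = z at hz
  obtain ⟨hzX, hmin⟩ := isAnalyticCenter_iff.1 hz
  have hnorm := h.localNorm_le_of_gradient_eq_zero (fun y => hf.tendsto_atTop)
    (Real.sqrt_pos.2 hν) (fun y => hf.inner_gradient_le hpd) hzX (h.gradient_eq_zero hzX hmin) hx u
  rw [Real.sq_sqrt hν.le] at hnorm
  calc inner ℝ ξ u ≤ dualLocalNorm f z ξ * localNorm f z u := h.inner_le_dualLocalNorm_mul hzX ξ u
    _ ≤ dualLocalNorm f z ξ * ((ν + 2 * √ν) * localNorm f x u) :=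
      mul_le_mul_of_nonneg_left hnorm (Real.sqrt_nonneg _)
    _ = (ν + 2 * √ν) * dualLocalNorm f z ξ * localNorm f x u := by ring

theorem IsSelfConcordantBarrier.inner_add_gradient_le (hf : IsSelfConcordantBarrier X f ν)
    (hpd : ∀ x ∈ interior X, ∀ u : Vec p, u ≠ 0 → 0 < inner ℝ (hess f x u) u)
    (hcenter : (∃ z, IsAnalyticCenter X f z) ∨ ξ = 0) (hx : x ∈ interior X) (u : Vec p) :
    inner ℝ (ξ + gradient f x) u ≤ (√ν + cbar X f ν ξ) * localNorm f x u := by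
  rw [inner_add_left]
  linarith [hf.inner_le_cbar_mul hpd hcenter hx u, hf.inner_gradient_le hpd hx u]

end Barrier

/-! ### Optimality conditions and the solution path -/

namespace IsProperClosedConvex

variable {g : Vec p → EReal} {a y : Vec p}

theorem coe_toReal (hg : IsProperClosedConvex g) (hy : g y ≠ ⊤) : ((g y).toReal : EReal) = g y :=
  EReal.coe_toReal hy (hg.ne_bot y)

theorem toReal_add_smul_le (hg : IsProperClosedConvex g) (ha : g a ≠ ⊤) (hy : g y ≠ ⊤) {t : ℝ}
    (ht : t ∈ Icc (0 : ℝ) 1) :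
    g (a + t • (y - a)) ≠ ⊤ ∧
      (g (a + t • (y - a))).toReal ≤ (g a).toReal + t * ((g y).toReal - (g a).toReal) := by
  have hle : g (a + t • (y - a)) ≤
      (((g a).toReal + t * ((g y).toReal - (g a).toReal) : ℝ) : EReal) :=
    hg.convex_epigraph.add_smul_sub_mem (x := (a, (g a).toReal)) (y := (y, (g y).toReal))
      (hg.coe_toReal ha).ge (hg.coe_toReal hy).ge ht
  have hne := (hle.trans_lt (EReal.coe_lt_top _)).ne
  exact ⟨hne, EReal.coe_le_coe_iff.1 ((hg.coe_toReal hne).trans_le hle)⟩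

theorem toReal_le_of_isLocalMin (hg : IsProperClosedConvex g) {h : Vec p → ℝ} {d : Vec p}
    (hd : HasGradientAt h d a) (ha : g a ≠ ⊤)
    (hmin : ∀ᶠ z in 𝓝 a, g z ≠ ⊤ → h a + (g a).toReal ≤ h z + (g z).toReal) (hy : g y ≠ ⊤) :
    (g a).toReal ≤ (g y).toReal + inner ℝ d (y - a) := by
  have hline : Tendsto (fun t : ℝ => a + t • (y - a)) (𝓝 0) (𝓝 a) := by
    have hcont : Continuous fun t : ℝ => a + t • (y - a) := by fun_prop
    simpa using hcont.tendsto 0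
  have hderiv : HasDerivAt (fun t : ℝ => h (a + t • (y - a))) (inner ℝ d (y - a)) 0 := by
    have hd₀ : HasFDerivAt h (InnerProductSpace.toDual ℝ (Vec p) d) (a + (0 : ℝ) • (y - a)) := by
      simpa using hd.hasFDerivAt
    simpa [Function.comp_def] using hd₀.comp_hasDerivAt 0 (hasDerivAt_line a (y - a) 0)
  have hslope : ∀ᶠ t : ℝ in 𝓝[>] 0, (g a).toReal - (g y).toReal ≤
      t⁻¹ • (h (a + (0 + t) • (y - a)) - h (a + (0 : ℝ) • (y - a))) := by
    filter_upwards [(hline.eventually hmin).filter_mono nhdsWithin_le_nhds,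
      Ioc_mem_nhdsGT (zero_lt_one' ℝ)] with t hmin_t ht
    obtain ⟨hne, hle⟩ := hg.toReal_add_smul_le ha hy ⟨ht.1.le, ht.2⟩
    rw [zero_add, zero_smul, add_zero, smul_eq_mul, le_inv_mul_iff₀ ht.1]
    linarith [hmin_t hne]
  linarith [ge_of_tendsto hderiv.tendsto_slope_zero_right hslope]

end IsProperClosedConvex

/-- The real-valued counterpart of `F_τ`, meaningful on `int X ∩ dom g`. -/
def paramValue (f : Vec p → ℝ) (g : Vec p → EReal) (ξ : Vec p) (τ : ℝ) (x : Vec p) : ℝ :=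
  τ * f x - (1 - τ) * inner ℝ ξ x + (g x).toReal

/-- The gradient `τ∇f(x) - (1 - τ)ξ` of the smooth part `f_τ` of `F_τ`. -/
def paramGradient (f : Vec p → ℝ) (ξ : Vec p) (τ : ℝ) (x : Vec p) : Vec p :=
  τ • gradient f x - (1 - τ) • ξ

section SolutionPath

variable {X : Set (Vec p)} {f : Vec p → ℝ} {g : Vec p → EReal} {ξ a b y z : Vec p} {τ τ' s : ℝ}

theorem hasGradientAt_paramGradient (hf : DifferentiableAt ℝ f a) :
    HasGradientAt (fun x => τ * f x - (1 - τ) * inner ℝ ξ x) (paramGradient f ξ τ a) a := by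
  rw [hasGradientAt_iff_hasFDerivAt]
  refine ((hf.hasGradientAt.hasFDerivAt.const_mul τ).sub
    ((innerSL ℝ ξ).hasFDerivAt.const_mul (1 - τ))).congr_fderiv ?_
  ext v
  simp [paramGradient]

theorem paramObjective_eq_coe (hg : IsProperClosedConvex g) (hy : y ∈ interior X)
    (hgy : g y ≠ ⊤) : paramObjective X f g ξ τ y = paramValue f g ξ τ y := by
  rw [paramObjective, extendTop, if_pos hy, paramValue, EReal.coe_add, hg.coe_toReal hgy]

theorem paramObjective_eq_top (hg : IsProperClosedConvex g) (hy : y ∈ interior X → g y = ⊤) :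
    paramObjective X f g ξ τ y = ⊤ := by
  rw [paramObjective, extendTop]
  split_ifs with hyX
  · rw [hy hyX, EReal.coe_add_top]
  · exact EReal.top_add_of_ne_bot (hg.ne_bot y)

theorem isArgmin_paramObjective_iff (hg : IsProperClosedConvex g) :
    IsArgmin (paramObjective X f g ξ τ) a ↔ a ∈ interior X ∩ {x | g x ≠ ⊤} ∧
      ∀ y ∈ interior X ∩ {x | g x ≠ ⊤}, paramValue f g ξ τ a ≤ paramValue f g ξ τ y :=
  isArgmin_iff_of_eq_coe (fun _ hy => paramObjective_eq_coe hg hy.1 hy.2) fun _ hy =>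
    paramObjective_eq_top hg fun hyX => of_not_not fun hgy => hy ⟨hyX, hgy⟩

theorem paramObjective_one : paramObjective X f g ξ 1 = objective X f g := by
  funext x
  simp [objective, paramObjective, extendTop]

namespace IsNondegSelfConcordant

theorem toReal_le_add_inner (h : IsNondegSelfConcordant (interior X) f)
    (hg : IsProperClosedConvex g) (ha : IsArgmin (paramObjective X f g ξ τ) a) (hy : g y ≠ ⊤) :
    (g a).toReal ≤ (g y).toReal + inner ℝ (paramGradient f ξ τ a) (y - a) := by
  obtain ⟨haS, hmin⟩ := (isArgmin_paramObjective_iff hg).1 ha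
  exact hg.toReal_le_of_isLocalMin
    (hasGradientAt_paramGradient ((h.contDiffAt haS.1).differentiableAt (by norm_num))) haS.2
    (Filter.mem_of_superset (h.isOpen.mem_nhds haS.1) fun z hz hgz => hmin z ⟨hz, hgz⟩) hy

/-- Monotonicity of `∂g`, applied to the optimality conditions of `a = x*_τ` and `b = x*_τ'`. -/
theorem mul_inner_gradient_sub_le (h : IsNondegSelfConcordant (interior X) f)
    (hg : IsProperClosedConvex g) (ha : IsArgmin (paramObjective X f g ξ τ) a)
    (hb : IsArgmin (paramObjective X f g ξ τ') b) :
    τ' * inner ℝ (gradient f b - gradient f a) (b - a) ≤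
      (τ - τ') * inner ℝ (ξ + gradient f a) (b - a) := by
  have hab := h.toReal_le_add_inner hg ha ((isArgmin_paramObjective_iff hg).1 hb).1.2
  have hba := h.toReal_le_add_inner hg hb ((isArgmin_paramObjective_iff hg).1 ha).1.2
  rw [← neg_sub b a, inner_neg_right] at hba
  simp only [paramGradient, inner_sub_left, inner_add_left, real_inner_smul_left] at *
  linarith

theorem mul_localNorm_sub_le (h : IsNondegSelfConcordant (interior X) f)
    (hg : IsProperClosedConvex g) (hs : 0 ≤ s)
    (hinner : ∀ u, inner ℝ (ξ + gradient f a) u ≤ s * localNorm f a u)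
    (ha : IsArgmin (paramObjective X f g ξ τ) a) (hb : IsArgmin (paramObjective X f g ξ τ') b)
    (hτ' : 0 ≤ τ') :
    τ' * localNorm f a (b - a) ≤ |τ' - τ| * s * (1 + localNorm f a (b - a)) := by
  have haX := ((isArgmin_paramObjective_iff hg).1 ha).1.1
  have hbX := ((isArgmin_paramObjective_iff hg).1 hb).1.1
  have hpath := h.mul_inner_gradient_sub_le hg ha hb
  have hmono := mul_le_mul_of_nonneg_left (h.le_inner_gradient_sub haX hbX) hτ'
  have hlin : (τ - τ') * inner ℝ (ξ + gradient f a) (b - a) ≤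
      |τ' - τ| * (s * localNorm f a (b - a)) := by
    have hbound := hinner ((τ - τ') • (b - a))
    rwa [real_inner_smul_right, localNorm_smul, abs_sub_comm, mul_left_comm] at hbound
  rcases (localNorm_nonneg f a (b - a)).eq_or_lt with hr | hr
  · rw [← hr, mul_zero]
    positivity
  · generalize localNorm f a (b - a) = r at *
    have hle := hmono.trans (hpath.trans hlin)
    rw [mul_div_assoc', div_le_iff₀ (by positivity)] at hle
    refine le_of_mul_le_mul_left ?_ hr
    linarith

theorem isArgmin_unique (h : IsNondegSelfConcordant (interior X) f) (hg : IsProperClosedConvex g)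
    (hτ : 0 < τ) (ha : IsArgmin (paramObjective X f g ξ τ) a)
    (hb : IsArgmin (paramObjective X f g ξ τ) b) : a = b := by
  have haX := ((isArgmin_paramObjective_iff hg).1 ha).1.1
  have hpath := h.mul_inner_gradient_sub_le hg ha hb
  have hmono := h.le_inner_gradient_sub haX ((isArgmin_paramObjective_iff hg).1 hb).1.1
  rw [sub_self, zero_mul] at hpath
  have hle := hmono.trans (nonpos_of_mul_nonpos_right hpath hτ)
  have hr := localNorm_nonneg f a (b - a)
  rw [div_le_iff₀ (by positivity), zero_mul] at hle
  have hzero : localNorm f a (b - a) = 0 := pow_eq_zero_iff two_ne_zero |>.1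
    (le_antisymm hle (sq_nonneg _))
  exact (sub_eq_zero.1 (h.localNorm_eq_zero haX hzero)).symm

end IsNondegSelfConcordant

end SolutionPath

section Existence

variable {X : Set (Vec p)} {f : Vec p → ℝ} {g : Vec p → EReal} {ξ x₀ z y : Vec p} {τ : ℝ}

theorem exists_isArgmin_of_eventually_le {Φ : Vec p → EReal} (hΦ : LowerSemicontinuous Φ)
    (hz : Φ z ≠ ⊤) (hle : ∀ᶠ y in cocompact (Vec p), Φ z ≤ Φ y) : ∃ a, IsArgmin Φ a := by
  obtain ⟨K, hK, hKle⟩ := mem_cocompact.1 hle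
  obtain ⟨a, -, hmin⟩ := (hΦ.lowerSemicontinuousOn (insert z K)).exists_isMinOn
    (insert_nonempty z K) (hK.insert z)
  have haz : Φ a ≤ Φ z := hmin (mem_insert z K)
  refine ⟨a, ne_top_of_le_ne_top hz haz, fun y => ?_⟩
  by_cases hy : y ∈ K
  · exact hmin (mem_insert_of_mem z hy)
  · exact haz.trans (hKle hy)

theorem lowerSemicontinuous_extendTop (hf : ContinuousOn f (interior X))
    (hblow : ∀ y ∉ interior X, Tendsto f (𝓝[interior X] y) atTop) :
    LowerSemicontinuous (extendTop X f) := by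
  rw [lowerSemicontinuous_iff_isClosed_preimage]
  intro c
  induction c with
  | bot =>
    convert isClosed_empty
    ext y
    by_cases hy : y ∈ interior X <;> simp [extendTop, hy]
  | coe c =>
    convert isClosed_inter_setOf_le hf hblow c
    ext y
    by_cases hy : y ∈ interior X <;> simp [extendTop, hy]
  | top => simp

theorem lowerSemicontinuous_paramObjective (hg : IsProperClosedConvex g)
    (hf : ContinuousOn f (interior X))
    (hblow : ∀ y ∉ interior X, Tendsto f (𝓝[interior X] y) atTop) (hτ : 0 < τ) :
    LowerSemicontinuous (paramObjective X f g ξ τ) := by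
  have hlin : Continuous fun x : Vec p => -((1 - τ) * inner ℝ ξ x) := by fun_prop
  refine (lowerSemicontinuous_extendTop ?_ fun y hy => ?_).add' hg.closed fun x =>
    EReal.continuousAt_add (Or.inr (hg.ne_bot x)) (Or.inl ?_)
  · simpa only [sub_eq_add_neg] using! (continuousOn_const.mul hf).add hlin.continuousOn
  · simpa only [sub_eq_add_neg] using ((hblow y hy).const_mul_atTop hτ).atTop_add
      ((hlin.tendsto y).mono_left nhdsWithin_le_nhds)
  · rw [extendTop]
    split_ifs
    exacts [EReal.coe_ne_bot _, top_ne_bot]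

namespace IsNondegSelfConcordant

theorem exists_mul_norm_le {D : Set (Vec p)} (h : IsNondegSelfConcordant D f) (hz : z ∈ D) :
    ∃ c, 0 < c ∧ ∀ u, c * ‖u‖ ≤ localNorm f z u := by
  rcases (Metric.sphere (0 : Vec p) 1).eq_empty_or_nonempty with hempty | hne
  · refine ⟨1, one_pos, fun u => ?_⟩
    rcases eq_or_ne u 0 with rfl | hu
    · simp [localNorm_zero]
    · exact absurd (hempty.subset (by simp [norm_smul, hu] : ‖u‖⁻¹ • u ∈ _)) (notMem_empty _)
  · obtain ⟨w, hw, hmin⟩ := (isCompact_sphere (0 : Vec p) 1).exists_isMinOn hne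
      (f := localNorm f z) (by unfold localNorm; fun_prop)
    have hw₀ : w ≠ 0 := by
      rintro rfl
      simp at hw
    refine ⟨localNorm f z w, h.localNorm_pos hz hw₀, fun u => ?_⟩
    rcases eq_or_ne u 0 with rfl | hu
    · simp [localNorm_zero]
    have hle : localNorm f z w ≤ localNorm f z (‖u‖⁻¹ • u) := hmin (by simp [norm_smul, hu])
    rwa [localNorm_smul, abs_inv, abs_norm, ← div_eq_inv_mul,
      le_div_iff₀ (norm_pos_iff.2 hu)] at hle

theorem tendsto_localNorm_sub_cocompact {D : Set (Vec p)} (h : IsNondegSelfConcordant D f)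
    (hz : z ∈ D) : Tendsto (fun y => localNorm f z (y - z)) (cocompact (Vec p)) atTop := by
  obtain ⟨c, hc, hle⟩ := h.exists_mul_norm_le hz
  refine tendsto_atTop_mono (fun y => ?_)
    ((tendsto_dist_right_cocompact_atTop z).const_mul_atTop hc)
  rw [dist_eq_norm]
  exact hle (y - z)

/-- `F_τ = τ F + (1 - τ)(g - ⟨ξ, ·⟩)`, where `F` grows linearly away from its minimizer `z` and
`g - ⟨ξ, ·⟩` is bounded below because `ξ` is a subgradient. -/
theorem paramValue_growth (h : IsNondegSelfConcordant (interior X) f)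
    (hg : IsProperClosedConvex g) (hξ : IsSubgradient g x₀ ξ) (hz : IsArgmin (objective X f g) z)
    (hτ : 0 ≤ τ) (hτ₁ : τ ≤ 1) (hy : y ∈ interior X) (hgy : g y ≠ ⊤) :
    τ * (f z + (g z).toReal + (localNorm f z (y - z) / 2 - 1)) +
      (1 - τ) * ((g x₀).toReal - inner ℝ ξ x₀) ≤ paramValue f g ξ τ y := by
  rw [← paramObjective_one (ξ := ξ)] at hz
  have hr := localNorm_nonneg f z (y - z)
  have hlog : Real.log (1 + localNorm f z (y - z)) ≤ localNorm f z (y - z) / 2 + 1 := by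
    have hhalf := Real.log_le_sub_one_of_pos (x := (1 + localNorm f z (y - z)) / 2) (by positivity)
    rw [Real.log_div (by positivity) two_ne_zero] at hhalf
    linarith [Real.log_two_lt_d9]
  have hF : f z + (g z).toReal + (localNorm f z (y - z) / 2 - 1) ≤ f y + (g y).toReal := by
    have hopt := h.toReal_le_add_inner hg hz hgy
    rw [paramGradient, one_smul, sub_self, zero_smul, sub_zero] at hopt
    linarith [h.add_inner_gradient_add_le ((isArgmin_paramObjective_iff hg).1 hz).1.1 hy]
  have hsub : (g x₀).toReal - inner ℝ ξ x₀ ≤ (g y).toReal - inner ℝ ξ y := by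
    have hle := hξ.2 y
    rw [← hg.coe_toReal hgy, ← hg.coe_toReal hξ.1, ← EReal.coe_add, EReal.coe_le_coe_iff,
      inner_sub_right] at hle
    linarith
  rw [paramValue]
  linarith [mul_le_mul_of_nonneg_left hF hτ, mul_le_mul_of_nonneg_left hsub (sub_nonneg.2 hτ₁)]

theorem exists_isArgmin_paramObjective (h : IsNondegSelfConcordant (interior X) f)
    (hblow : ∀ y ∉ interior X, Tendsto f (𝓝[interior X] y) atTop) (hg : IsProperClosedConvex g)
    (hξ : IsSubgradient g x₀ ξ) (hz : IsArgmin (objective X f g) z) (hτ : 0 < τ) (hτ₁ : τ ≤ 1) :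
    ∃ a, IsArgmin (paramObjective X f g ξ τ) a := by
  have hzS := ((isArgmin_paramObjective_iff hg).1 ((paramObjective_one (ξ := ξ)) ▸ hz)).1
  refine exists_isArgmin_of_eventually_le (z := z)
    (lowerSemicontinuous_paramObjective hg h.contDiffOn.continuousOn hblow hτ)
    (by simp [paramObjective_eq_coe hg hzS.1 hzS.2]) ?_
  have hlarge := (((h.tendsto_localNorm_sub_cocompact hzS.1).atTop_div_const two_pos).atTop_add
    (tendsto_const_nhds (x := f z + (g z).toReal - 1))).const_mul_atTop hτ
  filter_upwards [hlarge.eventually_ge_atTop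
    (paramValue f g ξ τ z - (1 - τ) * ((g x₀).toReal - inner ℝ ξ x₀))] with y hy
  by_cases hyS : y ∈ interior X ∧ g y ≠ ⊤
  · rw [paramObjective_eq_coe hg hzS.1 hzS.2, paramObjective_eq_coe hg hyS.1 hyS.2,
      EReal.coe_le_coe_iff]
    linarith [h.paramValue_growth hg hξ hz hτ.le hτ₁ hyS.1 hyS.2]
  · exact le_top.trans_eq (paramObjective_eq_top hg (by tauto)).symm

end IsNondegSelfConcordant

end Existence

/-! ### The inexact proximal-Newton step -/

/-- The smooth part of the proximal-Newton subproblem at `x`: the quadratic model of `f_τ / τ`. -/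
def quadModel (f : Vec p → ℝ) (ξ : Vec p) (τ : ℝ) (x z : Vec p) : ℝ :=
  inner ℝ (gradient f x - (1 / τ - 1) • ξ) (z - x) + 1 / 2 * inner ℝ (hess f x (z - x)) (z - x)

section InexactStep

variable {X : Set (Vec p)} {f : Vec p → ℝ} {g : Vec p → EReal} {ξ x x' xbar b y z : Vec p}
  {τ δ : ℝ}

theorem mul_quadModel_add (hf : ContDiffAt ℝ 3 f x) (hτ : τ ≠ 0) (w : Vec p) :
    τ * quadModel f ξ τ x (z + w) = τ * quadModel f ξ τ x z +
      inner ℝ (paramGradient f ξ τ x + τ • hess f x (z - x)) w +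
        τ / 2 * inner ℝ (hess f x w) w := by
  rw [quadModel, quadModel, paramGradient, add_sub_right_comm, map_add]
  simp only [inner_add_left, inner_add_right, inner_sub_left, real_inner_smul_left,
    inner_hess_comm hf w (z - x)]
  field_simp
  ring

theorem hasGradientAt_mul_quadModel (hf : ContDiffAt ℝ 3 f x) (hτ : τ ≠ 0) :
    HasGradientAt (fun z => τ * quadModel f ξ τ x z)
      (paramGradient f ξ τ x + τ • hess f x (z - x)) z := by
  rw [hasGradientAt_iff_hasFDerivAt]
  have hsub : HasFDerivAt (fun y : Vec p => y - z) (ContinuousLinearMap.id ℝ (Vec p)) z :=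
    (hasFDerivAt_id z).sub_const z
  have hexpand (y : Vec p) := mul_quadModel_add (ξ := ξ) (z := z) hf hτ (y - z)
  simp only [add_sub_cancel] at hexpand
  generalize paramGradient f ξ τ x + τ • hess f x (z - x) = d at *
  rw [funext hexpand]
  refine ((((hasFDerivAt_const _ z).inner ℝ hsub).const_add _).add
    ((((hess f x).hasFDerivAt.comp z hsub).inner ℝ hsub).const_mul (τ / 2))).congr_fderiv ?_
  ext w
  simp [fderivInnerCLM_apply]

theorem subproblem_eq_coe (hg : IsProperClosedConvex g) (hz : g z ≠ ⊤) :
    subproblem f g ξ τ x z = (quadModel f ξ τ x z + 1 / τ * (g z).toReal : ℝ) := by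
  rw [subproblem, ← hg.coe_toReal hz, EReal.coe_add, EReal.coe_mul, EReal.toReal_coe]
  rfl

theorem subproblem_eq_top (hτ : 0 < τ) (hz : g z = ⊤) : subproblem f g ξ τ x z = ⊤ := by
  rw [subproblem, hz, EReal.coe_mul_top_of_pos (one_div_pos.2 hτ), EReal.coe_add_top]

theorem isArgmin_subproblem_iff (hg : IsProperClosedConvex g) (hτ : 0 < τ) :
    IsArgmin (subproblem f g ξ τ x) xbar ↔ g xbar ≠ ⊤ ∧ ∀ z, g z ≠ ⊤ →
      quadModel f ξ τ x xbar + 1 / τ * (g xbar).toReal ≤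
        quadModel f ξ τ x z + 1 / τ * (g z).toReal :=
  isArgmin_iff_of_eq_coe (S := {z | g z ≠ ⊤}) (fun _ hz => subproblem_eq_coe hg hz) fun _ hz =>
    subproblem_eq_top hτ (of_not_not hz)

theorem toReal_le_add_inner_of_isArgmin_subproblem (hf : ContDiffAt ℝ 3 f x)
    (hg : IsProperClosedConvex g) (hτ : 0 < τ) (hbar : IsArgmin (subproblem f g ξ τ x) xbar)
    (hy : g y ≠ ⊤) :
    (g xbar).toReal ≤ (g y).toReal +
      inner ℝ (paramGradient f ξ τ x + τ • hess f x (xbar - x)) (y - xbar) := by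
  obtain ⟨hgbar, hmin⟩ := (isArgmin_subproblem_iff hg hτ).1 hbar
  refine hg.toReal_le_of_isLocalMin (hasGradientAt_mul_quadModel hf hτ.ne') hgbar
    (Eventually.of_forall fun z hz => ?_) hy
  have hle := mul_le_mul_of_nonneg_left (hmin z hz) hτ.le
  field_simp at hle
  linarith

theorem IsInexactStep.exists_isArgmin_and_le (hstep : IsInexactStep f g ξ τ δ x x')
    (hg : IsProperClosedConvex g) (hτ : 0 < τ) :
    ∃ xbar, IsArgmin (subproblem f g ξ τ x) xbar ∧ g x' ≠ ⊤ ∧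
      τ * quadModel f ξ τ x x' + (g x').toReal ≤
        τ * quadModel f ξ τ x xbar + (g xbar).toReal + τ * (δ ^ 2 / 2) := by
  obtain ⟨xbar, hbar, hle⟩ := hstep
  have hgbar := ((isArgmin_subproblem_iff hg hτ).1 hbar).1
  rw [subproblem_eq_coe hg hgbar, ← EReal.coe_add] at hle
  have hg' : g x' ≠ ⊤ := fun htop =>
    EReal.coe_ne_top _ (top_le_iff.1 (subproblem_eq_top hτ htop ▸ hle))
  rw [subproblem_eq_coe hg hg', EReal.coe_le_coe_iff] at hle
  refine ⟨xbar, hbar, hg', ?_⟩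
  have hmul := mul_le_mul_of_nonneg_left hle hτ.le
  field_simp at hmul ⊢
  linarith

namespace IsNondegSelfConcordant

theorem localNorm_sub_le_of_isArgmin_subproblem (h : IsNondegSelfConcordant (interior X) f)
    (hg : IsProperClosedConvex g) (hτ : 0 < τ) (hx : x ∈ interior X)
    (hb : IsArgmin (paramObjective X f g ξ τ) b) (hr : localNorm f x (b - x) < 1)
    (hbar : IsArgmin (subproblem f g ξ τ x) xbar) :
    localNorm f x (xbar - b) ≤ localNorm f x (b - x) ^ 2 / (1 - localNorm f x (b - x)) := by
  obtain ⟨hbX, hgb⟩ := ((isArgmin_paramObjective_iff hg).1 hb).1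
  have hopt_bar := toReal_le_add_inner_of_isArgmin_subproblem (h.contDiffAt hx) hg hτ hbar hgb
  have hopt_b := h.toReal_le_add_inner hg hb ((isArgmin_subproblem_iff hg hτ).1 hbar).1
  have hmodel := (abs_le.1 (h.abs_inner_gradient_sub_sub_hess_le hx hbX hr (xbar - b))).2
  have hN := localNorm_nonneg f x (xbar - b)
  have hsq := h.localNorm_sq hx (xbar - b)
  have hsplit : hess f x (xbar - x) = hess f x (xbar - b) + hess f x (b - x) := by
    rw [← map_add, sub_add_sub_cancel]
  rw [← neg_sub xbar b, inner_neg_right, hsplit] at hopt_bar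
  simp only [paramGradient, inner_add_left, inner_sub_left, real_inner_smul_left] at *
  rw [← hsq] at hopt_bar
  generalize localNorm f x (xbar - b) = N at *
  generalize hε : localNorm f x (b - x) ^ 2 / (1 - localNorm f x (b - x)) = ε at *
  have hε₀ : 0 ≤ ε := hε ▸ div_nonneg (sq_nonneg _) (sub_nonneg.2 hr.le)
  have hNε : N * N ≤ ε * N := by
    refine le_of_mul_le_mul_left ?_ hτ
    linarith [mul_le_mul_of_nonneg_left hmodel hτ.le]
  rcases hN.eq_or_lt with rfl | hN₀
  · exact hε₀
  · exact le_of_mul_le_mul_right hNε hN₀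

/-- The subproblem is strongly convex, with modulus `1` in the local norm at `x`. -/
theorem localNorm_sub_le_of_quadModel_le (h : IsNondegSelfConcordant (interior X) f)
    (hg : IsProperClosedConvex g) (hτ : 0 < τ) (hδ : 0 ≤ δ) (hx : x ∈ interior X)
    (hbar : IsArgmin (subproblem f g ξ τ x) xbar) (hg' : g x' ≠ ⊤)
    (hle : τ * quadModel f ξ τ x x' + (g x').toReal ≤
      τ * quadModel f ξ τ x xbar + (g xbar).toReal + τ * (δ ^ 2 / 2)) :
    localNorm f x (x' - xbar) ≤ δ := by
  have hopt := toReal_le_add_inner_of_isArgmin_subproblem (h.contDiffAt hx) hg hτ hbar hg'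
  have hexpand := mul_quadModel_add (ξ := ξ) (z := xbar) (h.contDiffAt hx) hτ.ne' (x' - xbar)
  rw [add_sub_cancel, ← h.localNorm_sq hx] at hexpand
  refine le_of_sq_le_sq (le_of_mul_le_mul_left ?_ hτ) hδ
  linarith

theorem localNorm_inexactStep_sub_le (h : IsNondegSelfConcordant (interior X) f)
    (hg : IsProperClosedConvex g) (hτ : 0 < τ) (hδ : 0 ≤ δ) (hx : x ∈ interior X)
    (hb : IsArgmin (paramObjective X f g ξ τ) b) (hr : localNorm f x (b - x) < 1)
    (hstep : IsInexactStep f g ξ τ δ x x') :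
    localNorm f x (x' - b) ≤ localNorm f x (b - x) ^ 2 / (1 - localNorm f x (b - x)) + δ := by
  obtain ⟨xbar, hbar, hg', hle⟩ := hstep.exists_isArgmin_and_le hg hτ
  rw [← sub_add_sub_cancel' xbar b x']
  exact (h.localNorm_add_le hx _ _).trans
    (add_le_add (h.localNorm_sub_le_of_isArgmin_subproblem hg hτ hx hb hr hbar)
      (h.localNorm_sub_le_of_quadModel_le hg hτ hδ hx hbar hg' hle))

theorem localNorm_inexactStep_sub_le_div (h : IsNondegSelfConcordant (interior X) f)
    (hg : IsProperClosedConvex g) (hτ : 0 < τ) (hδ : 0 ≤ δ) (hx : x ∈ interior X)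
    (hb : IsArgmin (paramObjective X f g ξ τ) b) (hl : localNorm f b (x - b) < 1 / 2)
    (hstep : IsInexactStep f g ξ τ δ x x') :
    localNorm f b (x' - b) ≤ localNorm f b (x - b) ^ 2 /
      ((1 - localNorm f b (x - b)) ^ 2 * (1 - 2 * localNorm f b (x - b))) +
        δ / (1 - localNorm f b (x - b)) := by
  have hbX := ((isArgmin_paramObjective_iff hg).1 hb).1.1
  have hr := h.localNorm_le_div hbX hx (hl.trans one_half_lt_one) (x - b)
  have hb' := h.mul_localNorm_le hbX hx (hl.trans one_half_lt_one) (x' - b)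
  have hstep_le := h.localNorm_inexactStep_sub_le hg hτ hδ hx hb (δ := δ) (x' := x')
  rw [localNorm_sub_rev f x x b] at hr
  have hr₀ := localNorm_nonneg f x (b - x)
  generalize localNorm f b (x - b) = l at *
  have hl₁ : 0 < 1 - l := by linarith
  have hl₂ : 0 < 1 - 2 * l := by linarith
  have hsub : 1 - l / (1 - l) = (1 - 2 * l) / (1 - l) := by
    field_simp
    ring
  have hpos : 0 < 1 - l / (1 - l) := hsub ▸ div_pos hl₂ hl₁
  have hquad : localNorm f x (b - x) ^ 2 / (1 - localNorm f x (b - x)) ≤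
      (l / (1 - l)) ^ 2 / (1 - l / (1 - l)) := by gcongr
  calc localNorm f b (x' - b)
      ≤ ((l / (1 - l)) ^ 2 / (1 - l / (1 - l)) + δ) / (1 - l) := by
        rw [le_div_iff₀' hl₁]
        linarith [hstep_le (by linarith) hstep]
    _ = l ^ 2 / ((1 - l) ^ 2 * (1 - 2 * l)) + δ / (1 - l) := by
        rw [hsub]
        field_simp

end IsNondegSelfConcordant

end InexactStep

/-! ### Step sizes and parameter sequences -/

section Constants

variable {s σ l r δ : ℝ}

theorem sqrt_lt_one (hσ : σ < 1) : √σ < 1 := (Real.sqrt_lt' one_pos).2 (by rwa [one_pow])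

theorem lt_of_C₀_pos (hC : 0 < C₀ σ) : 0.31 < σ := by
  rw [C₀] at hC
  have hlt : 10 / 18 < √(σ - 0.01) := by linarith
  linarith [Real.lt_sqrt (by norm_num) |>.1 hlt]

theorem C₀_mul_pow_le_Δ (hσ : σ ≤ 1) (k : ℕ) : C₀ σ * √σ ^ k ≤ Δ σ k := by
  have hpow : √σ ^ k ≤ 1 := pow_le_one₀ (Real.sqrt_nonneg σ) (Real.sqrt_le_one.2 hσ)
  rw [C₀, Δ]
  gcongr

theorem Δ_pos (hC : 0 < C₀ σ) (hσ : σ ≤ 1) (k : ℕ) : 0 < Δ σ k := by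
  have hσ₀ : 0 < σ := by linarith [lt_of_C₀_pos hC]
  exact (by positivity : 0 < C₀ σ * √σ ^ k).trans_le (C₀_mul_pow_le_Δ hσ k)

theorem Δ_le (hσ : σ ≤ 1) (k : ℕ) : Δ σ k ≤ 0.045 := by
  have hsq : √(σ - 0.01) ^ 2 ≤ 1 :=
    pow_le_one₀ (Real.sqrt_nonneg _) (Real.sqrt_le_one.2 (by linarith))
  rw [Δ]
  nlinarith [sq_nonneg (√(σ - 0.01) / 10 - √σ ^ k / 9)]

theorem sqrt_pow_sq (hσ : 0 ≤ σ) (k : ℕ) : (√σ ^ k) ^ 2 = σ ^ k := by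
  rw [pow_right_comm, Real.sq_sqrt hσ]

/-- The term `-(√σ)^k / 18` in `Δ_k` absorbs `0.05 σ^k`. -/
theorem add_Δ_le (hσ : 0 ≤ σ) (k : ℕ) :
    0.05 * σ ^ k + Δ σ k ≤ √(σ - 0.01) / 10 * √σ ^ k := by
  have hsq := sqrt_pow_sq hσ k
  rw [Δ]
  linarith [pow_nonneg hσ k]

theorem le_of_mul_le_sqrt_mul_pow (hσ : σ ≤ 1) {k : ℕ}
    (hl : 0.955 * l ≤ √(σ - 0.01) / 10 * √σ ^ k) : l ≤ 0.105 := by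
  have hpow : √σ ^ k ≤ 1 := pow_le_one₀ (Real.sqrt_nonneg σ) (Real.sqrt_le_one.2 hσ)
  have hsqrt : √(σ - 0.01) ≤ 1 := Real.sqrt_le_one.2 (by linarith)
  have hle := mul_le_one₀ hsqrt (by positivity) hpow
  linarith

theorem sq_div_add_div_le (hσ : 0.1 ≤ σ) (hσ₁ : σ ≤ 1) {k : ℕ} (hl₀ : 0 ≤ l)
    (hl : 0.955 * l ≤ √(σ - 0.01) / 10 * √σ ^ k) (hδ : δ ≤ 0.05 * σ ^ k / 113) :
    l ^ 2 / ((1 - l) ^ 2 * (1 - 2 * l)) + δ / (1 - l) ≤ 0.05 * σ ^ (k + 1) := by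
  have hl₁ := le_of_mul_le_sqrt_mul_pow hσ₁ hl
  have hσk : 0 ≤ σ ^ k := by positivity
  have hσk' : 0.1 * σ ^ k ≤ σ ^ (k + 1) := by
    rw [pow_succ']
    gcongr
  have hden : 0.6 ≤ (1 - l) ^ 2 * (1 - 2 * l) := by nlinarith
  have hsq : l ^ 2 ≤ 0.011 * σ ^ (k + 1) := by
    have hpow := pow_le_pow_left₀ (by positivity) hl 2
    rw [mul_pow, mul_pow, div_pow, Real.sq_sqrt (by linarith), sqrt_pow_sq (by linarith)] at hpow
    rw [pow_succ' σ k] at hσk' ⊢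
    linarith
  have hnewton : l ^ 2 / ((1 - l) ^ 2 * (1 - 2 * l)) ≤ 2 * l ^ 2 := by
    rw [div_le_iff₀ (by linarith)]
    nlinarith [sq_nonneg l]
  have hinexact : δ / (1 - l) ≤ 0.001 * σ ^ k := by
    rw [div_le_iff₀ (by linarith)]
    nlinarith
  linarith

theorem Ctilde_denom_pos {t : ℝ} (hC : 0 < C₀ σ) (h : 0 < Ctilde t σ) :
    0 < t * (1 + C₀ σ) * (1 - √σ) - C₀ σ :=
  (div_pos_iff_of_pos_left hC).1 h

theorem lt_one_of_Ctilde_pos {t : ℝ} (ht : 0 ≤ t) (hC : 0 < C₀ σ) (h : 0 < Ctilde t σ) :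
    σ < 1 := by
  by_contra! hσ
  have hnonpos : t * (1 + C₀ σ) * (1 - √σ) ≤ 0 :=
    mul_nonpos_of_nonneg_of_nonpos (by positivity) (sub_nonpos.2 (Real.one_le_sqrt.2 hσ))
  linarith [Ctilde_denom_pos hC h]

theorem C₀_eq : C₀ 0.3236 = 1 / 2250 := by
  have hsqrt : √(0.3236 - 0.01) = 0.56 := by
    rw [Real.sqrt_eq_iff_mul_self_eq_of_pos] <;> norm_num
  rw [C₀, hsqrt]
  norm_num

/-- At `σ = 0.3236` the root `√(σ - 0.01) = 0.56` is rational, and `τ₀ = K / (1 + K)` makes the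
squared term of the condition on `σ` vanish. -/
theorem exists_sigmaCondition_and_Ctilde_pos (hs : 1 ≤ s) :
    ∃ t σ : ℝ, 0 < t ∧ t < 1 ∧ 0.318642 < σ ∧ σ < 1 ∧ SigmaCondition s t σ ∧ 0 < Ctilde t σ := by
  set K : ℝ := 2251 * s with hK
  have hK₁ : 1 ≤ K := by linarith
  have ht : 1 - K / (1 + K) = 1 / (1 + K) := by
    field_simp
    ring
  refine ⟨K / (1 + K), 0.3236, by positivity, (div_lt_one (by positivity)).2 (by linarith),
    by norm_num, by norm_num, ⟨by rw [C₀_eq]; norm_num, ?_⟩, ?_⟩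
  · have hone : K / (1 + K) * (1 / 2250) / (1 / (1 + K) * (1 + 1 / 2250) * s) = 1 := by
      rw [hK]
      field_simp
      norm_num
    rw [C₀_eq, ht, hone]
    norm_num
  · rw [Ctilde, C₀_eq]
    refine div_pos (by norm_num) ?_
    have hhalf : 1 / 2 ≤ K / (1 + K) := by
      rw [div_le_div_iff₀ two_pos (by positivity)]
      linarith
    have hsqrt : 0.4 ≤ 1 - √(0.3236 : ℝ) := by
      have hle : √(0.3236 : ℝ) ≤ 0.6 := Real.sqrt_le_iff.2 ⟨by norm_num, by norm_num⟩
      linarith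
    have hle : (1 / 2 : ℝ) * (1 + 1 / 2250) * 0.4 ≤
      K / (1 + K) * (1 + 1 / 2250) * (1 - √0.3236) := by gcongr
    linarith

end Constants

/-- A parameter sequence `(τ_k)` of the scheme, where `s` stands for `√ν_f + c̄₀`. -/
structure IsParamSequence (s σ : ℝ) (τ : ℕ → ℝ) : Prop where
  s_pos : 0 < s
  sigma_le_one : σ ≤ 1
  sigmaCondition : SigmaCondition s (τ 0) σ
  zero_pos : 0 < τ 0
  zero_lt_one : τ 0 < 1
  succ_eq (k : ℕ) : τ (k + 1) = min 1 ((1 + Δ σ k / ((1 + Δ σ k) * s)) * τ k)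

namespace IsParamSequence

variable {s σ : ℝ} {τ : ℕ → ℝ}

theorem C₀_pos (hτ : IsParamSequence s σ τ) : 0 < C₀ σ := hτ.sigmaCondition.1

theorem sigma_pos (hτ : IsParamSequence s σ τ) : 0 < σ := by linarith [lt_of_C₀_pos hτ.C₀_pos]

theorem Δ_pos (hτ : IsParamSequence s σ τ) (k : ℕ) : 0 < Δ σ k :=
  HomotopyPN.Δ_pos hτ.C₀_pos hτ.sigma_le_one k

theorem le_one (hτ : IsParamSequence s σ τ) (k : ℕ) : τ k ≤ 1 := by
  cases k with
  | zero => exact hτ.zero_lt_one.le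
  | succ k => exact (hτ.succ_eq k).trans_le (min_le_left _ _)

theorem pos (hτ : IsParamSequence s σ τ) (k : ℕ) : 0 < τ k := by
  induction k with
  | zero => exact hτ.zero_pos
  | succ k ih =>
    have hs := hτ.s_pos
    have hΔ := hτ.Δ_pos k
    rw [hτ.succ_eq]
    positivity

theorem monotone (hτ : IsParamSequence s σ τ) : Monotone τ := by
  refine monotone_nat_of_le_succ fun k => ?_
  have hs := hτ.s_pos
  have hΔ := hτ.Δ_pos k
  rw [hτ.succ_eq]
  refine le_min (hτ.le_one k) (le_mul_of_one_le_left (hτ.pos k).le ?_)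
  linarith [(by positivity : 0 ≤ Δ σ k / ((1 + Δ σ k) * s))]

theorem mul_pow_le_div (hτ : IsParamSequence s σ τ) (k : ℕ) :
    C₀ σ / ((1 + C₀ σ) * s) * √σ ^ k ≤ Δ σ k / ((1 + Δ σ k) * s) := by
  have hs := hτ.s_pos
  have hC := hτ.C₀_pos
  have hΔ := hτ.Δ_pos k
  have hpow : √σ ^ k ≤ 1 := pow_le_one₀ (Real.sqrt_nonneg σ) (Real.sqrt_le_one.2 hτ.sigma_le_one)
  rw [div_mul_eq_mul_div, div_le_div_iff₀ (by positivity) (by positivity), ← mul_assoc,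
    ← mul_assoc]
  refine mul_le_mul_of_nonneg_right ?_ hs.le
  linarith [C₀_mul_pow_le_Δ hτ.sigma_le_one k,
    mul_le_mul_of_nonneg_left hpow (by positivity : 0 ≤ C₀ σ * Δ σ k)]

/-- The condition on `σ` is the case `k = 0`. In each later step `1 - τ_k` drops by at least
`E τ₀ (√σ)^k` with `E = C₀ / ((1 + C₀) s)`. -/
theorem mul_one_sub_le (hτ : IsParamSequence s σ τ) (k : ℕ) :
    (1 - τ k) * (1 - √σ) ≤ C₀ σ / ((1 + C₀ σ) * s) * τ 0 * √σ ^ k := by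
  have hs := hτ.s_pos
  have hC := hτ.C₀_pos
  have hρ : 0 ≤ 1 - √σ := sub_nonneg.2 (Real.sqrt_le_one.2 hτ.sigma_le_one)
  induction k with
  | zero =>
    have h₀ : 0 < 1 - τ 0 := sub_pos.2 hτ.zero_lt_one
    have hle : 1 - √σ ≤ τ 0 * C₀ σ / ((1 - τ 0) * (1 + C₀ σ) * s) := by
      linarith [Real.le_sqrt_of_sq_le hτ.sigmaCondition.2]
    calc (1 - τ 0) * (1 - √σ)
        ≤ (1 - τ 0) * (τ 0 * C₀ σ / ((1 - τ 0) * (1 + C₀ σ) * s)) := by gcongr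
      _ = C₀ σ / ((1 + C₀ σ) * s) * τ 0 * √σ ^ 0 := by field_simp
  | succ k ih =>
    have hinc := mul_le_mul (hτ.mul_pow_le_div k) (hτ.monotone (Nat.zero_le k)) hτ.zero_pos.le
      (div_pos (hτ.Δ_pos k) (mul_pos (by linarith [hτ.Δ_pos k]) hs)).le
    rw [hτ.succ_eq, pow_succ]
    rcases min_choice 1 ((1 + Δ σ k / ((1 + Δ σ k) * s)) * τ k) with hmin | hmin
    · rw [hmin, sub_self, zero_mul]
      have h₀ := hτ.zero_pos
      positivity
    · rw [hmin]
      linarith [mul_le_mul_of_nonneg_right hinc hρ]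

theorem one_sub_le_mul (hτ : IsParamSequence s σ τ) (hσ : σ < 1) (k : ℕ) :
    1 - τ k ≤ τ 0 * (C₀ σ * √σ ^ k / ((1 + C₀ σ) * s * (1 - √σ))) := by
  have hρ : 0 < 1 - √σ := sub_pos.2 (sqrt_lt_one hσ)
  refine ((le_div_iff₀ hρ).2 (hτ.mul_one_sub_le k)).trans_eq ?_
  field_simp

theorem one_sub_le (hτ : IsParamSequence s σ τ) (hσ : σ < 1) (k : ℕ) :
    1 - τ k ≤ C₀ σ * √σ ^ k / ((1 + C₀ σ) * s * (1 - √σ)) := by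
  have hs := hτ.s_pos
  have hC := hτ.C₀_pos
  have hρ : 0 < 1 - √σ := sub_pos.2 (sqrt_lt_one hσ)
  exact (hτ.one_sub_le_mul hσ k).trans
    (mul_le_of_le_one_left (by positivity) hτ.zero_lt_one.le)

theorem tendsto_one_sub (hτ : IsParamSequence s σ τ) (hσ : σ < 1) :
    Tendsto (fun k => 1 - τ k) atTop (𝓝 0) := by
  refine squeeze_zero (fun k => sub_nonneg.2 (hτ.le_one k)) (hτ.one_sub_le hσ) ?_
  simpa using ((tendsto_pow_atTop_nhds_zero_of_lt_one (Real.sqrt_nonneg σ)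
    (sqrt_lt_one hσ)).const_mul (C₀ σ)).div_const ((1 + C₀ σ) * s * (1 - √σ))

end IsParamSequence

/-! ### Convergence of the scheme -/

theorem IsNondegSelfConcordant.tendsto_of_tendsto_localNorm {D : Set (Vec p)} {f : Vec p → ℝ}
    {z : Vec p} (h : IsNondegSelfConcordant D f) (hz : z ∈ D) {ι : Type*} {l : Filter ι}
    {x : ι → Vec p} (hx : Tendsto (fun i => localNorm f z (x i - z)) l (𝓝 0)) :
    Tendsto x l (𝓝 z) := by
  obtain ⟨c, hc, hle⟩ := h.exists_mul_norm_le hz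
  rw [tendsto_iff_norm_sub_tendsto_zero]
  refine squeeze_zero (fun i => norm_nonneg _)
    (fun i => (le_div_iff₀' hc).2 (hle (x i - z))) ?_
  simpa using hx.div_const c

theorem exists_forall_le_mul_pow {u : ℕ → ℝ} {ρ c : ℝ} (hρ : 0 < ρ)
    (h : ∀ᶠ k in atTop, u k ≤ c * ρ ^ k) : ∃ C, ∀ k, u k ≤ C * ρ ^ k := by
  have hbdd : BddAbove (range fun k => u k / ρ ^ k) := by
    refine IsBoundedUnder.bddAbove_range ⟨c, eventually_map.2 ?_⟩
    filter_upwards [h] with k hk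
    exact (div_le_iff₀ (by positivity)).2 hk
  obtain ⟨C, hC⟩ := hbdd
  exact ⟨C, fun k => (div_le_iff₀ (by positivity)).1 (hC (mem_range_self k))⟩

/-- A composite problem for which the path `τ ↦ x*_τ` is defined on `(0, 1]`, with a bound `s` on
the dual local norm of `ξ + ∇f`; for a barrier one can take `s = √ν_f + c̄₀`. -/
structure IsHomotopyProblem (X : Set (Vec p)) (f : Vec p → ℝ) (g : Vec p → EReal) (ξ : Vec p)
    (s : ℝ) : Prop where
  selfConcordant : IsNondegSelfConcordant (interior X) f
  tendsto_atTop : ∀ y ∉ interior X, Tendsto f (𝓝[interior X] y) atTop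
  proper : IsProperClosedConvex g
  inner_le : ∀ a ∈ interior X, ∀ u, inner ℝ (ξ + gradient f a) u ≤ s * localNorm f a u
  s_pos : 0 < s
  exists_isArgmin (τ : ℝ) : 0 < τ → τ ≤ 1 → ∃ a, IsArgmin (paramObjective X f g ξ τ) a

theorem IsSelfConcordantBarrier.one_le_sqrt_add_cbar {X : Set (Vec p)} {f : Vec p → ℝ} {ν : ℝ}
    (hf : IsSelfConcordantBarrier X f ν) (ξ : Vec p) : 1 ≤ √ν + cbar X f ν ξ :=
  le_add_of_le_of_nonneg (Real.one_le_sqrt.2 hf.one_le)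
    (cbar_nonneg X f (zero_le_one.trans hf.one_le) ξ)

theorem IsSelfConcordantBarrier.isHomotopyProblem {X : Set (Vec p)} {f : Vec p → ℝ}
    {g : Vec p → EReal} {ν : ℝ} {ξ x₀ z : Vec p} (hf : IsSelfConcordantBarrier X f ν)
    (hpd : ∀ x ∈ interior X, ∀ u : Vec p, u ≠ 0 → 0 < inner ℝ (hess f x u) u)
    (hg : IsProperClosedConvex g) (hξ : IsSubgradient g x₀ ξ)
    (hcenter : (∃ z, IsAnalyticCenter X f z) ∨ ξ = 0) (hz : IsArgmin (objective X f g) z) :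
    IsHomotopyProblem X f g ξ (√ν + cbar X f ν ξ) where
  selfConcordant := hf.isNondegSelfConcordant hpd
  tendsto_atTop _ := hf.tendsto_atTop
  proper := hg
  inner_le _ := hf.inner_add_gradient_le hpd hcenter
  s_pos := zero_lt_one.trans_le (hf.one_le_sqrt_add_cbar ξ)
  exists_isArgmin _ := (hf.isNondegSelfConcordant hpd).exists_isArgmin_paramObjective
    (fun _ => hf.tendsto_atTop) hg hξ hz

namespace IsHomotopyProblem

variable {X : Set (Vec p)} {f : Vec p → ℝ} {g : Vec p → EReal} {ξ a x z : Vec p} {s τ τ' c d : ℝ}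

theorem existsUnique_isArgmin (P : IsHomotopyProblem X f g ξ s) (hτ : 0 < τ) (hτ₁ : τ ≤ 1) :
    ∃! a, IsArgmin (paramObjective X f g ξ τ) a := by
  obtain ⟨a, ha⟩ := P.exists_isArgmin τ hτ hτ₁
  exact ⟨a, ha, fun b hb => P.selfConcordant.isArgmin_unique P.proper hτ hb ha⟩

theorem isArgmin_paramSol (P : IsHomotopyProblem X f g ξ s) (hτ : 0 < τ) (hτ₁ : τ ≤ 1) :
    IsArgmin (paramObjective X f g ξ τ) (paramSol X f g ξ τ) :=
  isArgmin_argmin (P.exists_isArgmin τ hτ hτ₁)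

theorem mem_interior (P : IsHomotopyProblem X f g ξ s)
    (ha : IsArgmin (paramObjective X f g ξ τ) a) : a ∈ interior X :=
  ((isArgmin_paramObjective_iff P.proper).1 ha).1.1

theorem localNorm_paramSol_sub_le (P : IsHomotopyProblem X f g ξ s) (hτ : 0 < τ) (hττ' : τ ≤ τ')
    (hτ' : τ' ≤ 1) (hd : 0 ≤ d) (hle : τ' ≤ (1 + d / ((1 + d) * s)) * τ) :
    localNorm f (paramSol X f g ξ τ) (paramSol X f g ξ τ' - paramSol X f g ξ τ) ≤ d := by
  have hs := P.s_pos
  have hτ'₀ := hτ.trans_le hττ'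
  have ha := P.isArgmin_paramSol hτ (hττ'.trans hτ')
  have hpath := P.selfConcordant.mul_localNorm_sub_le P.proper hs.le
    (P.inner_le _ (P.mem_interior ha)) ha (P.isArgmin_paramSol hτ'₀ hτ') hτ'₀.le
  rw [abs_of_nonneg (sub_nonneg.2 hττ')] at hpath
  set r := localNorm f (paramSol X f g ξ τ) (paramSol X f g ξ τ' - paramSol X f g ξ τ)
  have hr : 0 ≤ r := localNorm_nonneg _ _ _
  have hstep : (τ' - τ) * s ≤ τ' * (d / (1 + d)) := by
    calc (τ' - τ) * s ≤ d / ((1 + d) * s) * τ * s := by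
          gcongr
          linarith
      _ = τ * (d / (1 + d)) := by field_simp
      _ ≤ τ' * (d / (1 + d)) := by gcongr
  have hrel : r ≤ d / (1 + d) * (1 + r) := by
    refine le_of_mul_le_mul_left (hpath.trans ?_) hτ'₀
    rw [← mul_assoc]
    gcongr
  rw [div_mul_eq_mul_div, le_div_iff₀ (by positivity)] at hrel
  linarith

theorem mem_interior_of_localDist_lt_one (P : IsHomotopyProblem X f g ξ s) (hτ : 0 < τ)
    (hτ₁ : τ ≤ 1) (hx : localDist X f g ξ τ x < 1) : x ∈ interior X := by
  simpa using P.selfConcordant.add_mem_of_localNorm_lt_one P.tendsto_atTop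
    (P.mem_interior (P.isArgmin_paramSol hτ hτ₁)) hx

theorem one_sub_mul_localDist_le (P : IsHomotopyProblem X f g ξ s) (hτ : 0 < τ) (hττ' : τ ≤ τ')
    (hτ' : τ' ≤ 1) (hd : d < 1)
    (hle : localNorm f (paramSol X f g ξ τ) (paramSol X f g ξ τ' - paramSol X f g ξ τ) ≤ d) :
    (1 - d) * localDist X f g ξ τ' x ≤ localDist X f g ξ τ x + d := by
  have h := P.selfConcordant
  have ha := P.mem_interior (P.isArgmin_paramSol hτ (hττ'.trans hτ'))
  have hb := P.mem_interior (P.isArgmin_paramSol (hτ.trans_le hττ') hτ')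
  unfold localDist
  set a := paramSol X f g ξ τ
  set b := paramSol X f g ξ τ'
  have htriangle : localNorm f a (x - b) ≤ localNorm f a (x - a) + d := by
    have hadd := h.localNorm_add_le ha (x - a) (a - b)
    rw [sub_add_sub_cancel, localNorm_sub_rev f a a b] at hadd
    linarith
  calc (1 - d) * localNorm f b (x - b)
      ≤ (1 - localNorm f a (b - a)) * localNorm f b (x - b) := by
        gcongr
        exact localNorm_nonneg _ _ _
    _ ≤ localNorm f a (x - b) :=
        (le_div_iff₀' (by linarith)).1 (h.localNorm_le_div ha hb (hle.trans_lt hd) _)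
    _ ≤ localNorm f a (x - a) + d := htriangle

theorem localNorm_sub_solution_le (P : IsHomotopyProblem X f g ξ s)
    (hz : IsArgmin (objective X f g) z) (hτ : 0 < τ) (hτ₁ : τ ≤ 1)
    (hc : localNorm f z (paramSol X f g ξ τ - z) ≤ c) (hc₁ : c < 1) :
    localNorm f z (x - z) ≤ localDist X f g ξ τ x / (1 - c) + c := by
  have h := P.selfConcordant
  have hzX := P.mem_interior (paramObjective_one.symm ▸ hz : IsArgmin (paramObjective X f g ξ 1) z)
  have ha := P.mem_interior (P.isArgmin_paramSol hτ hτ₁)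
  unfold localDist
  set a := paramSol X f g ξ τ
  have hadd := h.localNorm_add_le hzX (x - a) (a - z)
  rw [sub_add_sub_cancel] at hadd
  have hchange : localNorm f z (x - a) ≤ localNorm f a (x - a) / (1 - c) := by
    rw [le_div_iff₀' (sub_pos.2 hc₁)]
    refine le_trans ?_ (h.mul_localNorm_le hzX ha (hc.trans_lt hc₁) (x - a))
    gcongr
    exact localNorm_nonneg _ _ _
  linarith

end IsHomotopyProblem

/-- The inexact proximal-Newton homotopy scheme with parameters `τ_k`, accuracies `δ_k` and
iterates `x_k`. -/
structure IsHomotopyScheme (X : Set (Vec p)) (f : Vec p → ℝ) (g : Vec p → EReal) (ξ : Vec p)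
    (s σ : ℝ) (τ δ : ℕ → ℝ) (x : ℕ → Vec p) : Prop extends
    IsHomotopyProblem X f g ξ s, IsParamSequence s σ τ where
  localDist_zero_le : localDist X f g ξ (τ 0) (x 0) ≤ 0.05
  accuracy_nonneg (k : ℕ) : 0 ≤ δ k
  accuracy_le (k : ℕ) : δ k ≤ localDist X f g ξ (τ k) (x k) / 113
  isInexactStep (k : ℕ) : IsInexactStep f g ξ (τ (k + 1)) (δ k) (x k) (x (k + 1))

namespace IsHomotopyScheme

variable {X : Set (Vec p)} {f : Vec p → ℝ} {g : Vec p → EReal} {ξ z : Vec p} {s σ : ℝ}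
  {τ δ : ℕ → ℝ} {x : ℕ → Vec p}

theorem mul_localDist_succ_param_le (S : IsHomotopyScheme X f g ξ s σ τ δ x) {k : ℕ}
    (hk : localDist X f g ξ (τ k) (x k) ≤ 0.05 * σ ^ k) :
    0.955 * localDist X f g ξ (τ (k + 1)) (x k) ≤ √(σ - 0.01) / 10 * √σ ^ k := by
  have hΔ := Δ_le S.sigma_le_one k
  have hmono := S.monotone k.le_succ
  have hpath := S.localNorm_paramSol_sub_le (S.pos k) hmono (S.le_one (k + 1)) (S.Δ_pos k).le
    ((S.succ_eq k).trans_le (min_le_right _ _))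
  calc 0.955 * localDist X f g ξ (τ (k + 1)) (x k)
      ≤ (1 - Δ σ k) * localDist X f g ξ (τ (k + 1)) (x k) := by
        gcongr
        · exact localNorm_nonneg _ _ _
        · linarith
    _ ≤ localDist X f g ξ (τ k) (x k) + Δ σ k :=
        S.one_sub_mul_localDist_le (S.pos k) hmono (S.le_one (k + 1)) (by linarith) hpath
    _ ≤ 0.05 * σ ^ k + Δ σ k := by gcongr
    _ ≤ √(σ - 0.01) / 10 * √σ ^ k := add_Δ_le S.sigma_pos.le k

theorem localDist_succ_le (S : IsHomotopyScheme X f g ξ s σ τ δ x) {k : ℕ}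
    (hk : localDist X f g ξ (τ k) (x k) ≤ 0.05 * σ ^ k) :
    localDist X f g ξ (τ (k + 1)) (x (k + 1)) ≤ 0.05 * σ ^ (k + 1) := by
  have hl := S.mul_localDist_succ_param_le hk
  have hσk : σ ^ k ≤ 1 := pow_le_one₀ S.sigma_pos.le S.sigma_le_one
  have hxX := S.mem_interior_of_localDist_lt_one (S.pos k) (S.le_one k) (by linarith)
  have hδ : δ k ≤ 0.05 * σ ^ k / 113 := by linarith [S.accuracy_le k]
  refine (S.selfConcordant.localNorm_inexactStep_sub_le_div S.proper (S.pos (k + 1))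
    (S.accuracy_nonneg k) hxX (S.isArgmin_paramSol (S.pos (k + 1)) (S.le_one (k + 1))) ?_
    (S.isInexactStep k)).trans ?_
  · exact (le_of_mul_le_sqrt_mul_pow S.sigma_le_one hl).trans_lt (by norm_num)
  · exact sq_div_add_div_le (by linarith [lt_of_C₀_pos S.C₀_pos]) S.sigma_le_one
      (localNorm_nonneg _ _ _) hl hδ

theorem localDist_le (S : IsHomotopyScheme X f g ξ s σ τ δ x) (k : ℕ) :
    localDist X f g ξ (τ k) (x k) ≤ 0.05 * σ ^ k := by
  induction k with
  | zero => simpa using S.localDist_zero_le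
  | succ k ih => exact S.localDist_succ_le ih

theorem tendsto_localDist (S : IsHomotopyScheme X f g ξ s σ τ δ x) (hσ : σ < 1) :
    Tendsto (fun k => localDist X f g ξ (τ k) (x k)) atTop (𝓝 0) := by
  refine squeeze_zero (fun k => localNorm_nonneg _ _ _) S.localDist_le ?_
  simpa using (tendsto_pow_atTop_nhds_zero_of_lt_one S.sigma_pos.le hσ).const_mul 0.05

theorem lt_one_of_Ctilde_pos (S : IsHomotopyScheme X f g ξ s σ τ δ x)
    (hC : 0 < Ctilde (τ 0) σ) : σ < 1 :=
  HomotopyPN.lt_one_of_Ctilde_pos S.zero_pos.le S.C₀_pos hC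

/-- The relation `τ_k r ≤ (1 - τ_k) s (1 + r)` for the distance `r` of `x*_{τ_k}` to `x*` is
solved for `r` using the geometric bound on `1 - τ_k`. -/
theorem localNorm_paramSol_sub_solution_le (S : IsHomotopyScheme X f g ξ s σ τ δ x)
    (hz : IsArgmin (objective X f g) z) (hC : 0 < Ctilde (τ 0) σ) (k : ℕ) :
    localNorm f z (paramSol X f g ξ (τ k) - z) ≤ Ctilde (τ 0) σ * √σ ^ k := by
  have hz₁ : IsArgmin (paramObjective X f g ξ 1) z := paramObjective_one.symm ▸ hz
  have hs := S.s_pos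
  have hC₀ := S.C₀_pos
  have hσ := S.lt_one_of_Ctilde_pos hC
  have hρ : 0 < 1 - √σ := sub_pos.2 (sqrt_lt_one hσ)
  have hpow : √σ ^ k ≤ 1 := pow_le_one₀ (Real.sqrt_nonneg σ) (sqrt_lt_one hσ).le
  have ha := S.isArgmin_paramSol (S.pos k) (S.le_one k)
  have hpath := S.selfConcordant.mul_localNorm_sub_le S.proper hs.le
    (S.inner_le z (S.mem_interior hz₁)) hz₁ ha (S.pos k).le
  rw [abs_sub_comm, abs_of_nonneg (sub_nonneg.2 (S.le_one k))] at hpath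
  set r := localNorm f z (paramSol X f g ξ (τ k) - z)
  have hr : 0 ≤ r := localNorm_nonneg _ _ _
  have hrel : r ≤ C₀ σ * √σ ^ k * (1 + r) / ((1 + C₀ σ) * (1 - √σ)) := by
    refine le_of_mul_le_mul_left ?_ S.zero_pos
    calc τ 0 * r ≤ τ k * r := by
          gcongr
          exact S.monotone k.zero_le
      _ ≤ (1 - τ k) * s * (1 + r) := hpath
      _ ≤ τ 0 * (C₀ σ * √σ ^ k / ((1 + C₀ σ) * s * (1 - √σ))) * s * (1 + r) := by
        gcongr
        exact S.one_sub_le_mul hσ k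
      _ = τ 0 * (C₀ σ * √σ ^ k * (1 + r) / ((1 + C₀ σ) * (1 - √σ))) := by field_simp
  rw [le_div_iff₀ (by positivity)] at hrel
  rw [Ctilde, div_mul_eq_mul_div, le_div_iff₀ (Ctilde_denom_pos hC₀ hC)]
  have hτr : τ 0 * (r * ((1 + C₀ σ) * (1 - √σ))) ≤ r * ((1 + C₀ σ) * (1 - √σ)) :=
    mul_le_of_le_one_left (by positivity) S.zero_lt_one.le
  linarith [mul_le_mul_of_nonneg_left hpow (by positivity : 0 ≤ C₀ σ * r)]

theorem localNorm_sub_le (S : IsHomotopyScheme X f g ξ s σ τ δ x)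
    (hz : IsArgmin (objective X f g) z) (hC : 0 < Ctilde (τ 0) σ) {k : ℕ}
    (hk : Ctilde (τ 0) σ * √σ ^ k < 1) :
    localNorm f z (x k - z) ≤
      0.05 * σ ^ k / (1 - Ctilde (τ 0) σ * √σ ^ k) + Ctilde (τ 0) σ * √σ ^ k := by
  refine (S.localNorm_sub_solution_le hz (S.pos k) (S.le_one k)
    (S.localNorm_paramSol_sub_solution_le hz hC k) hk).trans ?_
  have := sub_pos.2 hk
  gcongr
  exact S.localDist_le k

theorem exists_localNorm_sub_le_mul_pow (S : IsHomotopyScheme X f g ξ s σ τ δ x)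
    (hz : IsArgmin (objective X f g) z) (hC : 0 < Ctilde (τ 0) σ) :
    ∃ C, ∀ k, localNorm f z (x k - z) ≤ C * √σ ^ k := by
  have hσ₀ := S.sigma_pos
  have hρ := sqrt_lt_one (S.lt_one_of_Ctilde_pos hC)
  refine exists_forall_le_mul_pow (c := 0.1 + Ctilde (τ 0) σ) (Real.sqrt_pos.2 hσ₀) ?_
  have hsmall : Tendsto (fun k => Ctilde (τ 0) σ * √σ ^ k) atTop (𝓝 0) := by
    simpa using (tendsto_pow_atTop_nhds_zero_of_lt_one (Real.sqrt_nonneg σ) hρ).const_mul _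
  filter_upwards [hsmall.eventually_lt_const (by norm_num : (0 : ℝ) < 1 / 2)] with k hk
  refine (S.localNorm_sub_le hz hC (by linarith)).trans ?_
  rw [add_mul]
  gcongr
  rw [div_le_iff₀ (by linarith)]
  have hpow : σ ^ k ≤ √σ ^ k := by
    rw [← sqrt_pow_sq hσ₀.le]
    exact pow_le_of_le_one (by positivity) (pow_le_one₀ (Real.sqrt_nonneg σ) hρ.le) two_ne_zero
  nlinarith [(by positivity : 0 < √σ ^ k)]

theorem tendsto_solution (S : IsHomotopyScheme X f g ξ s σ τ δ x)
    (hz : IsArgmin (objective X f g) z) (hC : 0 < Ctilde (τ 0) σ) : Tendsto x atTop (𝓝 z) := by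
  have hz₁ : IsArgmin (paramObjective X f g ξ 1) z := paramObjective_one.symm ▸ hz
  obtain ⟨C, hle⟩ := S.exists_localNorm_sub_le_mul_pow hz hC
  refine S.selfConcordant.tendsto_of_tendsto_localNorm (S.mem_interior hz₁)
    (squeeze_zero (fun k => localNorm_nonneg _ _ _) hle ?_)
  simpa using (tendsto_pow_atTop_nhds_zero_of_lt_one (Real.sqrt_nonneg σ)
    (sqrt_lt_one (S.lt_one_of_Ctilde_pos hC))).const_mul C

end IsHomotopyScheme

end HomotopyPN

end

open HomotopyPN in
theorem mainTheorem3 {p : ℕ} (X : Set (Vec p)) (f : Vec p → ℝ) (g : Vec p → EReal) (ν : ℝ)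
    -- `f` is a `ν`-self-concordant barrier of `X` with positive definite Hessian
    (hf : IsSelfConcordantBarrier X f ν)
    (hpd : ∀ x ∈ interior X, ∀ u : Vec p, u ≠ 0 → 0 < inner ℝ (hess f x u) u)
    (hg : IsProperClosedConvex g)
    -- `xstar` is an optimal solution of the composite problem
    (xstar : Vec p) (hxstar : IsArgmin (objective X f g) xstar)
    -- the iterates, with `ξ⁰ ∈ ∂g(x⁰)`
    (x : ℕ → Vec p) (ξ : Vec p) (hx0 : x 0 ∈ interior X) (hξ : IsSubgradient g (x 0) ξ)
    (hcenter : (∃ z, IsAnalyticCenter X f z) ∨ ξ = 0)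
    (τ δ : ℕ → ℝ) (hτ0 : 0 < τ 0) (hτ0' : τ 0 < 1)
    (σ : ℝ) (hσ : 0.318642 < σ) (hσ' : σ ≤ 1)
    (hσc : SigmaCondition (√ν + cbar X f ν ξ) (τ 0) σ)
    (hinit : localDist X f g ξ (τ 0) (x 0) ≤ 0.05)
    -- the parameter update, kept in `(0, 1]`
    (hτ : ∀ k, τ (k + 1) =
      min 1 ((1 + Δ σ k / ((1 + Δ σ k) * (√ν + cbar X f ν ξ))) * τ k))
    (hδ : ∀ k, 0 ≤ δ k) (hδ' : ∀ k, δ k ≤ localDist X f g ξ (τ k) (x k) / 113)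
    (hstep : ∀ k, IsInexactStep f g ξ (τ (k + 1)) (δ k) (x k) (x (k + 1))) :
    -- the points `x*_t` are well defined
    (∀ t : ℝ, 0 < t → t ≤ 1 → ∃! z, IsArgmin (paramObjective X f g ξ t) z) ∧
    (∀ k, localDist X f g ξ (τ k) (x k) ≤ 0.05 * σ ^ k) ∧
    (∀ k, 0 ≤ 1 - τ k) ∧
    (σ < 1 →
      (∀ k, 1 - τ k ≤
        C₀ σ * √σ ^ k / ((1 + C₀ σ) * (√ν + cbar X f ν ξ) * (1 - √σ))) ∧
      Filter.Tendsto (fun k => localDist X f g ξ (τ k) (x k)) Filter.atTop (nhds 0) ∧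
      Filter.Tendsto (fun k => 1 - τ k) Filter.atTop (nhds 0)) ∧
    (0 < Ctilde (τ 0) σ →
      (∀ k, Ctilde (τ 0) σ * √σ ^ k < 1 →
        localNorm f xstar (x k - xstar) ≤
          0.05 * σ ^ k / (1 - Ctilde (τ 0) σ * √σ ^ k) + Ctilde (τ 0) σ * √σ ^ k) ∧
      σ < 1 ∧
      (∃ C : ℝ, ∀ k, localNorm f xstar (x k - xstar) ≤ C * √σ ^ k) ∧
      Filter.Tendsto x Filter.atTop (nhds xstar)) ∧
    -- admissible parameters with `C̃₁ > 0` exist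
    (∃ t s : ℝ, 0 < t ∧ t < 1 ∧ 0.318642 < s ∧ s < 1 ∧
      SigmaCondition (√ν + cbar X f ν ξ) t s ∧ 0 < Ctilde t s) := by
  have P := hf.isHomotopyProblem hpd hg hξ hcenter hxstar
  have S : IsHomotopyScheme X f g ξ (√ν + cbar X f ν ξ) σ τ δ x :=
    { P with
      sigma_le_one := hσ'
      sigmaCondition := hσc
      zero_pos := hτ0
      zero_lt_one := hτ0'
      succ_eq := hτ
      localDist_zero_le := hinit
      accuracy_nonneg := hδ
      accuracy_le := hδ'
      isInexactStep := hstep }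
  refine ⟨fun t => P.existsUnique_isArgmin, S.localDist_le, fun k => sub_nonneg.2 (S.le_one k),
    fun hσ₁ => ⟨S.one_sub_le hσ₁, S.tendsto_localDist hσ₁, S.tendsto_one_sub hσ₁⟩,
    fun hC => ⟨fun k => S.localNorm_sub_le hxstar hC, S.lt_one_of_Ctilde_pos hC,
      S.exists_localNorm_sub_le_mul_pow hxstar hC, S.tendsto_solution hxstar hC⟩,
    exists_sigmaCondition_and_Ctilde_pos (hf.one_le_sqrt_add_cbar ξ)⟩
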